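/- Let $(L,v)$ be an algebraically closed field with a non-trivial valuation $v:L\to vL\cup\{\infty\}$ (written additively, $vL$ being its value group), and let $K\subseteq L$ be a subfield such that $(K,v|_K)$ is also an algebraically closed non-trivially valued field and is an elementary substructure of $(L,v)$ in the language of rings together with a binary relation symbol interpreted as $v(x)\le v(y)$ (so $K\prec L$ are models of ACVF). Let $vK=v(K^\times)\subseteq vL$, and regard $vK\subseteq vL$ as structures in the language $\{+,-,0,\le\}$ of ordered abelian groups. Then the following are equivalent: 1. $W_1(K,L)$: for every subset $D\subseteq L$ definable in $L$ with parameters from $L$, the set $D\cap K$ is definable in $K$ with parameters from $K$; 2. for every ball $B$ of $L$, that is, every set of the form $\{x\in L: v(x-a)\ge\gamma\}$ or $\{x\in L: v(x-a)>\gamma\}$ with $a\in L$ and $\gamma\in vL$, the set $B\cap K$ is definable in $K$ with parameters from $K$; 3. $T_1(vK,vL)$: for every $\gamma\in vL$ the type $\mathrm{tp}(\gamma/vK)$ is definable, i.e. for every formula $\varphi(x,y)$ in the language of ordered abelian groups, with $x$ a single variable and $y$ a finite tuple of variables, the set $\{b\in (vK)^{|y|}: vL\models\varphi(\gamma,b)\}$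 is definable in $vK$ with parameters from $vK$. -/

import Mathlib

open FirstOrder FirstOrder.Language

namespace ACVF

universe u v w w'

section ModelTheory

variable (𝓛 : FirstOrder.Language.{u, v}) {M : Type w} {N : Type w'} [𝓛.Structure M] [𝓛.Structure N]

/-- `W_n(M, N)` for an extension `f : M → N`: for every subset `t` of `N ^ n` definable with
parameters from `N`, the trace of `t` on `M ^ n` is definable in `M` with parameters from `M`. -/
def W (n : ℕ) (f : M ↪[𝓛] N) : Prop :=
  ∀ t : Set (Fin n → N), (Set.univ : Set N).Definable 𝓛 t →
    (Set.univ : Set M).Definable 𝓛 {x : Fin n → M | f ∘ x ∈ t}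

/-- `tp(a / M)` for a tuple `a` of an extension `f : M → N`: the set of all formulas in the
variables `Fin n` with parameters from `M` that hold at `a` in `N`. A formula with parameters is
written as a formula whose free variables are either parameters (elements of `M`) or proper
variables. -/
def tp {n : ℕ} (f : M ↪[𝓛] N) (a : Fin n → N) : Set (𝓛.Formula (M ⊕ Fin n)) :=
  {ψ | ψ.Realize (Sum.elim f a)}

/-- A set `p` of formulas over `M` (in particular a type) is definable if for every formula
`φ(y, x)` the set of `b` in `M ^ |y|` with `φ(b, x) ∈ p` is definable in `M` with parameters
from `M`. -/
def IsDefinableType {n : ℕ} (p : Set (𝓛.Formula (M ⊕ Fin n))) : Prop :=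
  ∀ (m : ℕ) (φ : 𝓛.Formula (Fin m ⊕ Fin n)),
    (Set.univ : Set M).Definable 𝓛 {b : Fin m → M | φ.relabel (Sum.map b id) ∈ p}

/-- `T_n(M, N)`: every `n`-type over `M` realized in the extension `N` is definable. -/
def T (n : ℕ) (f : M ↪[𝓛] N) : Prop :=
  ∀ a : Fin n → N, IsDefinableType 𝓛 (tp 𝓛 f a)

end ModelTheory

section OrderedGroups

/-- The function symbols `+, -, 0` of ordered abelian groups. -/
inductive GroupFunc : ℕ → Type
  | add : GroupFunc 2
  | neg : GroupFunc 1
  | zero : GroupFunc 0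

/-- The language `{+, -, 0, ≤}` of ordered abelian groups. -/
def oag : FirstOrder.Language := ⟨GroupFunc, orderRel⟩

/-- An ordered abelian group as a structure in the language of ordered abelian groups. -/
instance oagStructure (G : Type*) [AddCommGroup G] [LinearOrder G] : oag.Structure G where
  funMap {n} f :=
    match n, f with
    | _, .add => fun x => x 0 + x 1
    | _, .neg => fun x => -x 0
    | _, .zero => fun _ => 0
  RelMap {n} r :=
    match n, r with
    | _, .le => fun x => x 0 ≤ x 1

/-- The inclusion of a subgroup, as an embedding of ordered abelian groups. -/
def oagInclusion {G : Type*} [AddCommGroup G] [LinearOrder G] (H : AddSubgroup G) :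
    H ↪[oag] G where
  toFun := Subtype.val
  inj' := Subtype.val_injective
  map_fun' {n} f x := by cases f <;> rfl
  map_rel' {n} r x := by cases r; rfl

end OrderedGroups

section ValuedFields

/-- The relation symbol `x ∣ y` of valued fields. -/
inductive DivRel : ℕ → Type
  | div : DivRel 2

/-- The language of valued fields: the language of rings together with a binary relation symbol
for the divisibility relation. -/
def ldiv : FirstOrder.Language := ⟨ringFunc, DivRel⟩

variable {F : Type*} {Γ : Type*} [Field F] [AddCommGroup Γ] [LinearOrder Γ] [IsOrderedAddMonoid Γ]

/-- A valued field `(F, v)` as a structure in the language of valued fields: the ring symbols are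
interpreted as usual, and `x ∣ y` if and only if `v x ≤ v y`. -/
@[reducible]
def valuedFieldStructure (v : AddValuation F (WithTop Γ)) : ldiv.Structure F where
  funMap {n} f :=
    match n, f with
    | _, .add => fun x => x 0 + x 1
    | _, .mul => fun x => x 0 * x 1
    | _, .neg => fun x => -x 0
    | _, .zero => fun _ => 0
    | _, .one => fun _ => 1
  RelMap {n} r :=
    match n, r with
    | _, .div => fun x => v (x 0) ≤ v (x 1)

/-- Models of ACVF: algebraically closed non-trivially valued fields. -/
structure IsModel (v : AddValuation F (WithTop Γ)) : Prop where
  isAlgClosed : IsAlgClosed F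
  nontrivial : ∃ x : F, x ≠ 0 ∧ v x ≠ 0

/-- The value group `vK` of a subfield `K` of a valued field. -/
def valueGroup (v : AddValuation F (WithTop Γ)) (K : Subfield F) : AddSubgroup Γ where
  carrier := {γ | ∃ x ∈ K, v x = (γ : WithTop Γ)}
  zero_mem' := ⟨1, K.one_mem, by simp⟩
  add_mem' := by
    rintro _ _ ⟨x, hx, h⟩ ⟨y, hy, h'⟩
    exact ⟨x * y, K.mul_mem hx hy, by rw [v.map_mul, h, h', WithTop.coe_add]⟩
  neg_mem' := by
    rintro γ ⟨x, hx, h⟩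
    have hx0 : x ≠ 0 := by
      rintro rfl
      simp at h
    refine ⟨x⁻¹, K.inv_mem hx, ?_⟩
    have e : v x + v x⁻¹ = 0 := by rw [← v.map_mul, mul_inv_cancel₀ hx0, v.map_one]
    rw [h] at e
    cases hy : v x⁻¹ with
    | top => simp [hy] at e
    | coe δ =>
      rw [hy] at e
      have e' : γ + δ = 0 := by exact_mod_cast e
      rw [neg_eq_of_add_eq_zero_right e']

/-- The balls of a valued field, closed or open, with center in the field and radius in the
value group. -/
def IsBall (v : AddValuation F (WithTop Γ)) (B : Set F) : Prop :=
  ∃ (a : F) (γ : Γ), B = {x | (γ : WithTop Γ) ≤ v (x - a)} ∨ B = {x | (γ : WithTop Γ) < v (x - a)}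

end ValuedFields

end ACVF

/-! Everything reduces to one statement about cuts, `HasEndpoint`: each `γ` in the large value group
lies below all of `vK`, lies above all of it, or cuts it at an endpoint belonging to `vK`.

Definable sets are controlled by quantifier elimination, phrased through `FinDet`: membership
depends on finitely many sets of a given family. For divisible ordered abelian groups the family is
half-spaces, and variables are eliminated as in Fourier–Motzkin. For ACVF the family is comparisons
of values of polynomials. If a projection were not finitely determined, an ultrapower would contain
two tuples with the same quantifier-free type but different behaviour. Their generated fields are
isomorphic as valued fields, and the isomorphism extends to algebraic closures because valuation
rings over a given one are conjugate. One further element is then matched to finite accuracy inside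
the algebraic closure, by the one-variable analysis: polynomials split, so a comparison of their
values depends on finitely many balls (`finDet_polynomial`), and a finite ball configuration met by
some point is met by a point of the smaller field (`exists_same_balls`).

In one variable, definable sets are thus finitely determined by balls and points, which gives 1 ⇔ 2.
A ball meeting `K` can be recentred in `K`, so its trace depends only on the cut of its radius; an
endpoint makes the trace definable. Conversely, suppose the cut of `γ` has no endpoint. Any finite
set of elements of `vK` then misses an interval around `γ` with both ends in `vK`, so finitely many
balls of `K`, or half-lines of `vK`, cannot separate its two ends
(`exists_avoiding_of_not_hasEndpoint`). Hence 2 and 3 are each equivalent to the cut condition. -/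

namespace ACVF

/-! ### Sets determined by finitely many members of a family -/

section FiniteDetermination

variable {X Y κ κ' : Type*}

/-- A set `S` is finitely determined by a family of sets `A` if membership in `S` depends only on
membership in finitely many members of the family. -/
def FinDet (A : κ → Set X) (S : Set X) : Prop :=
  ∃ s : Finset κ, ∀ x y, (∀ k ∈ s, (x ∈ A k ↔ y ∈ A k)) → x ∈ S → y ∈ S

theorem FinDet.basic (A : κ → Set X) (k : κ) : FinDet A (A k) :=
  ⟨{k}, fun _ _ h hx => (h k (Finset.mem_singleton_self k)).1 hx⟩

theorem FinDet.empty (A : κ → Set X) : FinDet A ∅ := ⟨∅, fun _ _ _ hx => hx⟩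

theorem FinDet.compl {A : κ → Set X} {S : Set X} (h : FinDet A S) : FinDet A Sᶜ := by
  obtain ⟨s, hs⟩ := h
  exact ⟨s, fun x y hxy hx hy => hx (hs y x (fun k hk => (hxy k hk).symm) hy)⟩

theorem FinDet.inter {A : κ → Set X} {S T : Set X} (hS : FinDet A S) (hT : FinDet A T) :
    FinDet A (S ∩ T) := by
  classical
  obtain ⟨s, hs⟩ := hS
  obtain ⟨t, ht⟩ := hT
  exact ⟨s ∪ t, fun x y hxy hx =>
    ⟨hs x y (fun k hk => hxy k (Finset.mem_union_left _ hk)) hx.1,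
      ht x y (fun k hk => hxy k (Finset.mem_union_right _ hk)) hx.2⟩⟩

theorem FinDet.preimage {A : κ → Set X} {S : Set X} (h : FinDet A S) (g : Y → X) :
    FinDet (fun k => g ⁻¹' A k) (g ⁻¹' S) := by
  obtain ⟨s, hs⟩ := h
  exact ⟨s, fun x y hxy hx => hs (g x) (g y) hxy hx⟩

theorem FinDet.trans {A : κ → Set X} {B : κ' → Set X} {S : Set X} (h : FinDet A S)
    (hA : ∀ k, FinDet B (A k)) : FinDet B S := by
  classical
  obtain ⟨s, hs⟩ := h
  choose t ht using hA
  refine ⟨s.biUnion t, fun x y hxy hx => hs x y (fun k hk => ⟨ht k x y ?_, ht k y x ?_⟩) hx⟩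
  · exact fun l hl => hxy l (Finset.mem_biUnion.2 ⟨k, hk, hl⟩)
  · exact fun l hl => (hxy l (Finset.mem_biUnion.2 ⟨k, hk, hl⟩)).symm

/-- A set that is not finitely determined is split by two points of an ultrapower that are not
separated by any member of the family. -/
theorem exists_ultrafilter_of_not_finDet {A : κ → Set X} {S : Set X} (h : ¬ FinDet A S) :
    ∃ (W : Ultrafilter (Finset κ)) (x y : Finset κ → X), (∀ i, x i ∈ S) ∧ (∀ i, y i ∉ S) ∧
      ∀ k, ∀ᶠ i in (W : Filter (Finset κ)), (x i ∈ A k ↔ y i ∈ A k) := by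
  simp only [FinDet, not_exists, not_forall] at h
  choose x y hxy hx hy using h
  refine ⟨Ultrafilter.of Filter.atTop, x, y, hx, hy, fun k => ?_⟩
  refine Filter.Eventually.filter_mono (Ultrafilter.of_le _) ?_
  filter_upwards [Filter.eventually_ge_atTop {k}] with i hi
  exact hxy i k (hi (Finset.mem_singleton_self k))

end FiniteDetermination

/-! ### Definable sets: finite determination and induction on formulas -/

section DefinableSets

universe u v w

variable {𝓛 : FirstOrder.Language.{u, v}} {M : Type w} [𝓛.Structure M]

/-- Only finitely many membership patterns occur, and `S` is the union of the cells of those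
patterns realized by its points. -/
theorem FinDet.definable {κ : Type*} {α : Type*} {C : Set M} {A : κ → Set (α → M)}
    {S : Set (α → M)} (h : FinDet A S) (hA : ∀ k, C.Definable 𝓛 (A k)) : C.Definable 𝓛 S := by
  classical
  obtain ⟨s, hs⟩ := h
  let atom : Finset κ → κ → Set (α → M) := fun t k => if k ∈ t then A k else (A k)ᶜ
  have hatom : ∀ t k, C.Definable 𝓛 (atom t k) := by
    intro t k
    by_cases hk : k ∈ t
    · simpa [atom, hk] using hA k
    · simpa [atom, hk] using (hA k).compl
  let pat : (α → M) → Finset κ := fun x => s.filter fun k => x ∈ A k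
  have key : S = ⋃ t ∈ s.powerset.filter (fun t => ∃ x ∈ S, pat x = t), ⋂ k ∈ s, atom t k := by
    ext y
    simp only [Set.mem_iUnion, Set.mem_iInter, Finset.mem_filter, Finset.mem_powerset]
    constructor
    · intro hy
      refine ⟨pat y, ⟨Finset.filter_subset _ _, y, hy, rfl⟩, fun k hk => ?_⟩
      by_cases hyk : y ∈ A k <;> simp [atom, pat, hk, hyk]
    · rintro ⟨t, ⟨-, x, hx, rfl⟩, hy⟩
      refine hs x y (fun k hk => ?_) hx
      have := hy k hk
      by_cases hxk : x ∈ A k <;> simp [atom, pat, hk, hxk] at this <;> simp [hxk, this]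
  rw [key]
  exact Set.definable_biUnion_finset (fun t => Set.definable_biInter_finset (hatom t) s) _

/-- Induction on formulas in semantic form. Bound variables are adjoined to the index type, so
quantifier elimination comes down to the clauses `proj`, `equal` and `rel`. -/
theorem definable_induction (P : ∀ ι : Type, Set (ι → M) → Prop)
    (empty : ∀ ι, P ι ∅)
    (compl : ∀ ι S, P ι S → P ι Sᶜ)
    (inter : ∀ ι S T, P ι S → P ι T → P ι (S ∩ T))
    (reindex : ∀ (ι κ : Type) (g : ι → κ) S, P ι S → P κ {z | z ∘ g ∈ S})
    (proj : ∀ (ι : Type) S, P (Option ι) S → P ι {z | ∃ a, (fun o : Option ι => o.elim a z) ∈ S})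
    (equal : ∀ (ι : Type) (t₁ t₂ : 𝓛.Term (M ⊕ ι)),
      P ι {z | t₁.realize (Sum.elim id z) = t₂.realize (Sum.elim id z)})
    (rel : ∀ (ι : Type) (n : ℕ) (R : 𝓛.Relations n) (ts : Fin n → 𝓛.Term (M ⊕ ι)),
      P ι {z | Structure.RelMap R fun i => (ts i).realize (Sum.elim id z)})
    {α : Type} {C : Set M} {S : Set (α → M)} (hS : C.Definable 𝓛 S) : P α S := by
  obtain ⟨φ, rfl⟩ := Set.definable_iff_exists_formula_sum.1 hS
  have tm : ∀ {n : ℕ} (t : 𝓛.Term ((C ⊕ α) ⊕ Fin n)), ∃ t' : 𝓛.Term (M ⊕ (α ⊕ Fin n)),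
      ∀ z : α ⊕ Fin n → M, t'.realize (Sum.elim id z) =
        t.realize (Sum.elim (Sum.elim (fun c : C => (c : M)) (z ∘ Sum.inl)) (z ∘ Sum.inr)) := by
    intro n t
    refine ⟨t.relabel (Sum.elim (Sum.map (fun c : C => (c : M)) Sum.inl) (Sum.inr ∘ Sum.inr)),
      fun z => ?_⟩
    rw [Term.realize_relabel]
    congr 1
    ext ((c | a) | i) <;> rfl
  have main : ∀ {n : ℕ} (φ : 𝓛.BoundedFormula (C ⊕ α) n), P (α ⊕ Fin n) {z : α ⊕ Fin n → M |
      φ.Realize (Sum.elim (fun c : C => (c : M)) (z ∘ Sum.inl)) (z ∘ Sum.inr)} := by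
    intro n φ
    induction φ with
    | falsum =>
      exact empty _
    | equal t₁ t₂ =>
      obtain ⟨t₁', h₁⟩ := tm t₁
      obtain ⟨t₂', h₂⟩ := tm t₂
      have := equal _ t₁' t₂'
      simp only [h₁, h₂] at this
      exact this
    | rel R ts =>
      choose ts' h using fun i => tm (ts i)
      have := rel _ _ R ts'
      simp only [h] at this
      exact this
    | imp φ ψ h₁ h₂ =>
      have := compl _ _ (inter _ _ _ h₁ (compl _ _ h₂))
      convert this using 1
      ext z
      simp [BoundedFormula.realize_imp]
    | @all n φ h =>
      -- A universal quantifier is the complement of a projected complement; the last bound variable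
      -- becomes the coordinate `none`.
      have h' := compl _ _ (proj _ _ (reindex _ (Option (α ⊕ Fin n))
        (Sum.elim (fun a => some (Sum.inl a))
          (Fin.lastCases none fun i => some (Sum.inr i))) _ (compl _ _ h)))
      convert h' using 1
      ext z
      simp only [BoundedFormula.realize_all, Set.mem_ofPred_eq, Set.mem_compl_iff, not_exists,
        not_not]
      refine forall_congr' fun a => ?_
      have e : (((fun o : Option (α ⊕ Fin n) => o.elim a z) ∘
          (Sum.elim (fun a => some (Sum.inl a))
          (Fin.lastCases none fun i => some (Sum.inr i)))) ∘ Sum.inr : Fin (n + 1) → M)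
          = Fin.snoc (z ∘ Sum.inr) a := by
        ext i
        refine Fin.lastCases ?_ (fun i => ?_) i <;> simp
      rw [e]
      rfl
  have := reindex _ α (Sum.elim id Fin.elim0 : α ⊕ Fin 0 → α) _ (main φ)
  convert this using 1
  ext z
  simp only [Set.mem_ofPred_eq, Formula.Realize]
  refine iff_of_eq ?_
  congr 1
  exact Subsingleton.elim _ _

end DefinableSets

/-! ### One-variable analysis: polynomials, balls and approximation -/

section Balls

variable {E M Γ₀ : Type*} [Field E] [Field M] [LinearOrderedCommGroupWithZero Γ₀]
  (v : Valuation M Γ₀) (i : E →+* M)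

/-- The family of all closed and open balls of `M` with center and radius from `E`. -/
def ballFamily : (E × E) ⊕ (E × E) → Set M
  | .inl p => {x | v (x - i p.1) ≤ v (i p.2)}
  | .inr p => {x | v (x - i p.1) < v (i p.2)}

theorem finDet_ballFamily_of_finset (C : Finset (E × E)) {S : Set M}
    (h : ∀ x y, (∀ p ∈ C, (v (x - i p.1) ≤ v (i p.2) ↔ v (y - i p.1) ≤ v (i p.2)) ∧
      (v (x - i p.1) < v (i p.2) ↔ v (y - i p.1) < v (i p.2))) → x ∈ S → y ∈ S) :
    FinDet (ballFamily v i) S :=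
  ⟨C.disjSum C, fun x y hxy => h x y fun p hp =>
    ⟨hxy (.inl p) (Finset.inl_mem_disjSum.2 hp), hxy (.inr p) (Finset.inr_mem_disjSum.2 hp)⟩⟩

/-- Unequal values of `x - r` and `r - a` give the maximum by the ultrametric law; if they are
equal, the only possible drop is excluded by `h`. -/
theorem map_sub_eq_max {x r a : M} (h : v (x - r) ≤ v (x - a)) :
    v (x - a) = max (v (x - r)) (v (r - a)) := by
  have e : x - a = (x - r) + (r - a) := by ring
  by_cases hne : v (x - r) = v (r - a)
  · refine le_antisymm (e ▸ v.map_add _ _) ?_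
    rw [← hne, max_self]
    exact h
  · rw [e, v.map_add_of_distinct_val hne]

/-- With `r` and `a` in the small field, this turns "`r` is at least as near as `a`" into a ball
condition on `x`. -/
theorem le_map_sub_iff {x r a : M} : v (x - r) ≤ v (x - a) ↔ ¬ v (x - a) < v (r - a) := by
  constructor
  · intro h hlt
    rw [map_sub_eq_max v h] at hlt
    exact absurd (le_max_right _ _) (not_le.2 hlt)
  · intro h
    by_contra hlt
    rw [not_le] at hlt
    refine h ?_
    have := map_sub_eq_max v hlt.le
    rw [v.map_sub_swap a r] at this
    rcases max_choice (v (x - a)) (v (r - a)) with h' | h'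
    · exact absurd (this.trans h') hlt.ne'
    · rw [← h', ← this]
      exact hlt

theorem multiset_prod_max {ι : Type*} [DecidableEq ι] (s : Multiset ι) (g : ι → Γ₀) (t : Γ₀)
    (T : Finset ι) (hT : ∀ ρ ∈ s, (ρ ∈ T ↔ t ≤ g ρ)) :
    (s.map fun ρ => max t (g ρ)).prod =
      ((s.filter (· ∈ T)).map g).prod * t ^ (s.filter (· ∉ T)).card := by
  induction s using Multiset.induction with
  | empty => simp
  | cons a s ih =>
    have ih := ih fun ρ hρ => hT ρ (Multiset.mem_cons_of_mem hρ)
    have ha := hT a (Multiset.mem_cons_self a s)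
    by_cases h : a ∈ T
    · simp [h, ih, max_eq_right (ha.1 h), mul_assoc]
    · have : g a ≤ t := le_of_not_ge fun h' => h (ha.2 h')
      simp [h, ih, max_eq_left this, pow_succ]
      ac_rfl

variable [IsAlgClosed E]

theorem map_eval₂_eq_prod_roots (f : Polynomial E) (x : M) :
    v (f.eval₂ i x) = v (i f.leadingCoeff) * (f.roots.map fun ρ => v (x - i ρ)).prod := by
  conv_lhs => rw [(IsAlgClosed.splits f).eq_prod_roots]
  rw [Polynomial.eval₂_mul, Polynomial.eval₂_C, map_mul]
  congr 1
  rw [← Polynomial.coe_eval₂RingHom, map_multiset_prod, map_multiset_prod, Multiset.map_map,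
    Multiset.map_map]
  simp

/-- Comparison of two monomials in `t` with coefficients from `E` only depends on the position of
`t` with respect to the value of one element of `E`. -/
theorem exists_critical_value (e e' : E) (m m' : ℕ) : ∃ c : E, ∀ t t' : Γ₀, (t = 0 ↔ t' = 0) →
    (t ≤ v (i c) ↔ t' ≤ v (i c)) → (t < v (i c) ↔ t' < v (i c)) →
    v (i e) * t ^ m ≤ v (i e') * t ^ m' → v (i e) * t' ^ m ≤ v (i e') * t' ^ m' := by
  by_cases he : e = 0
  · exact ⟨0, fun t t' _ _ _ _ => by simp [he]⟩
  have hve : v (i e) ≠ 0 := by simpa using he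
  by_cases he' : e' = 0
  · refine ⟨0, fun t t' h0 _ _ h => ?_⟩
    have : t ^ m = 0 := by simpa [he', he] using h
    have hm : m ≠ 0 := by rintro rfl; simp at this
    have ht : t = 0 := by simpa [hm] using this
    simp [h0.1 ht, hm]
  have hve' : v (i e') ≠ 0 := by simpa using he'
  rcases lt_trichotomy m m' with hm | rfl | hm
  · obtain ⟨d, rfl⟩ := Nat.exists_eq_add_of_lt hm
    -- The two monomials cross where `t ^ (d + 1)` equals the value of `e / e'`; a root in `E`
    -- realizes this crossing point.
    obtain ⟨c, hc⟩ := IsAlgClosed.exists_pow_nat_eq (e / e') (Nat.succ_pos d)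
    have hcv : v (i e) = v (i e') * v (i c) ^ (d + 1) := by
      rw [← map_pow, ← map_pow, ← map_mul, ← map_mul, hc, mul_div_cancel₀ _ he']
    have key : ∀ t : Γ₀, t ≠ 0 →
        (v (i e) * t ^ m ≤ v (i e') * t ^ (m + d + 1) ↔ ¬ t < v (i c)) := by
      intro t ht
      have h1 : v (i e') * t ^ (m + d + 1) = (v (i e') * t ^ m) * t ^ (d + 1) := by
        rw [mul_assoc, ← pow_add, add_assoc]
      have h2 : v (i e) * t ^ m = (v (i e') * t ^ m) * v (i c) ^ (d + 1) := by
        rw [hcv, mul_right_comm]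
      rw [h1, h2, mul_le_mul_iff_right₀ (zero_lt_iff.2 (mul_ne_zero hve' (pow_ne_zero _ ht))),
        pow_le_pow_iff_left₀ zero_le zero_le (Nat.succ_ne_zero d), not_lt]
    refine ⟨c, fun t t' h0 _ h2 h => ?_⟩
    by_cases ht : t = 0
    · rwa [h0.1 ht, ← ht]
    · rw [key t' fun h => ht (h0.2 h), ← h2, ← key t ht]
      exact h
  · refine ⟨0, fun t t' h0 _ _ h => ?_⟩
    by_cases ht : t ^ m = 0
    · have hm : m ≠ 0 := by rintro rfl; simp at ht
      have ht : t = 0 := by simpa [hm] using ht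
      simp [h0.1 ht, hm]
    · exact mul_le_mul_left ((mul_le_mul_iff_left₀ (zero_lt_iff.2 ht)).1 h) _
  · obtain ⟨d, rfl⟩ := Nat.exists_eq_add_of_lt hm
    obtain ⟨c, hc⟩ := IsAlgClosed.exists_pow_nat_eq (e' / e) (Nat.succ_pos d)
    have hcv : v (i e') = v (i e) * v (i c) ^ (d + 1) := by
      rw [← map_pow, ← map_pow, ← map_mul, ← map_mul, hc, mul_div_cancel₀ _ he]
    have key : ∀ t : Γ₀, t ≠ 0 →
        (v (i e) * t ^ (m' + d + 1) ≤ v (i e') * t ^ m' ↔ t ≤ v (i c)) := by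
      intro t ht
      have h1 : v (i e) * t ^ (m' + d + 1) = (v (i e) * t ^ m') * t ^ (d + 1) := by
        rw [mul_assoc, ← pow_add, add_assoc]
      have h2 : v (i e') * t ^ m' = (v (i e) * t ^ m') * v (i c) ^ (d + 1) := by
        rw [hcv, mul_right_comm]
      rw [h1, h2, mul_le_mul_iff_right₀ (zero_lt_iff.2 (mul_ne_zero hve (pow_ne_zero _ ht))),
        pow_le_pow_iff_left₀ zero_le zero_le (Nat.succ_ne_zero d)]
    refine ⟨c, fun t t' h0 h1 _ h => ?_⟩
    by_cases ht : t = 0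
    · rwa [h0.1 ht, ← ht]
    · rw [key t' fun h => ht (h0.2 h), ← h1, ← key t ht]
      exact h

/-- A comparison of values of polynomials over `E` is determined by finitely many balls. -/
theorem finDet_polynomial (f g : Polynomial E) :
    FinDet (ballFamily v i) {x | v (f.eval₂ i x) ≤ v (g.eval₂ i x)} := by
  classical
  let R : Finset E := f.roots.toFinset ∪ g.roots.toFinset
  let coe : Polynomial E → E → Finset E → E := fun f r T =>
    f.leadingCoeff * ((f.roots.filter (· ∈ T)).map fun ρ => r - ρ).prod
  let deg : Polynomial E → Finset E → ℕ := fun f T => (f.roots.filter (· ∉ T)).card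
  choose crit hcrit using fun (r : E) (T : Finset E) =>
    exists_critical_value v i (coe f r T) (coe g r T) (deg f T) (deg g T)
  -- Pairs are (centre, radius). The first family decides which root is nearest and how its distance
  -- compares with distances between roots; the second locates that distance relative to the
  -- crossing point of the two resulting monomials.
  let C : Finset (E × E) := ((R ×ˢ R).image fun p => (p.1, p.2 - p.1)) ∪
    ((R ×ˢ R.powerset).image fun p => (p.1, crit p.1 p.2))
  refine finDet_ballFamily_of_finset v i C fun x y hxy hx => ?_
  rcases R.eq_empty_or_nonempty with hR | hR
  · have hf : f.roots = 0 := by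
      rw [← Multiset.toFinset_eq_empty]
      exact (Finset.union_eq_empty.1 hR).1
    have hg : g.roots = 0 := by
      rw [← Multiset.toFinset_eq_empty]
      exact (Finset.union_eq_empty.1 hR).2
    simp only [Set.mem_ofPred_eq, map_eval₂_eq_prod_roots, hf, hg, Multiset.map_zero] at hx ⊢
    exact hx
  obtain ⟨r, hr, hmin⟩ := R.exists_min_image (fun ρ => v (x - i ρ)) hR
  have hC₁ : ∀ ρ ∈ R, ∀ σ ∈ R, (v (x - i ρ) ≤ v (i (σ - ρ)) ↔ v (y - i ρ) ≤ v (i (σ - ρ))) ∧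
      (v (x - i ρ) < v (i (σ - ρ)) ↔ v (y - i ρ) < v (i (σ - ρ))) := fun ρ hρ σ hσ =>
    hxy (ρ, σ - ρ) (Finset.mem_union_left _ (Finset.mem_image.2
      ⟨(ρ, σ), Finset.mem_product.2 ⟨hρ, hσ⟩, rfl⟩))
  have hminy : ∀ ρ ∈ R, v (y - i r) ≤ v (y - i ρ) := by
    intro ρ hρ
    have := hmin ρ hρ
    rw [le_map_sub_iff, ← map_sub] at this ⊢
    rwa [← (hC₁ ρ hρ r hr).2]
  -- Roots in `T` contribute the constant `v (i (r - ρ))`, the others contribute `v (x - i r)`, so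
  -- each polynomial has the value of a monomial in `v (x - i r)`.
  let T : Finset E := R.filter fun ρ => v (x - i r) ≤ v (i (r - ρ))
  have hT : ∀ ρ ∈ R, (ρ ∈ T ↔ v (x - i r) ≤ v (i (r - ρ))) := fun ρ hρ => by simp [T, hρ]
  have hTy : ∀ ρ ∈ R, (ρ ∈ T ↔ v (y - i r) ≤ v (i (r - ρ))) := fun ρ hρ => by
    have := (hC₁ r hr ρ hρ).1
    have e : v (i (r - ρ)) = v (i (ρ - r)) := by
      rw [map_sub i, v.map_sub_swap, ← map_sub i]
    rw [hT ρ hρ, e]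
    exact this
  have hC₂ := hxy (r, crit r T) (Finset.mem_union_right _ (Finset.mem_image.2
      ⟨(r, T), Finset.mem_product.2 ⟨hr, Finset.mem_powerset.2 (Finset.filter_subset _ _)⟩, rfl⟩))
  have h0 : v (x - i r) = 0 ↔ v (y - i r) = 0 := by
    have := (hC₁ r hr r hr).1
    simpa using this
  have expand : ∀ (h : Polynomial E) (z : M), (∀ ρ ∈ h.roots, ρ ∈ R) →
      (∀ ρ ∈ R, v (z - i r) ≤ v (z - i ρ)) → (∀ ρ ∈ R, (ρ ∈ T ↔ v (z - i r) ≤ v (i (r - ρ)))) →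
      v (h.eval₂ i z) = v (i (coe h r T)) * v (z - i r) ^ deg h T := by
    intro h z hroots hz hzT
    rw [map_eval₂_eq_prod_roots, map_mul, map_mul, mul_assoc]
    congr 1
    have : (h.roots.map fun ρ => v (z - i ρ)) =
        h.roots.map fun ρ => max (v (z - i r)) (v (i (r - ρ))) :=
      Multiset.map_congr rfl fun ρ hρ => by
        rw [map_sub_eq_max v (hz ρ (hroots ρ hρ)), map_sub i]
    rw [this, multiset_prod_max _ _ _ T fun ρ hρ => hzT ρ (hroots ρ hρ), map_multiset_prod,
      map_multiset_prod, Multiset.map_map, Multiset.map_map]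
    rfl
  have hf : ∀ ρ ∈ f.roots, ρ ∈ R := fun ρ hρ =>
    Finset.mem_union_left _ (Multiset.mem_toFinset.2 hρ)
  have hg : ∀ ρ ∈ g.roots, ρ ∈ R := fun ρ hρ =>
    Finset.mem_union_right _ (Multiset.mem_toFinset.2 hρ)
  simp only [Set.mem_ofPred_eq] at hx ⊢
  rw [expand f x hf hmin hT, expand g x hg hmin hT] at hx
  rw [expand f y hf hminy hTy, expand g y hg hminy hTy]
  exact hcrit r T _ _ h0 hC₂.1 hC₂.2 hx

/-- An integral element that is generic with respect to finitely many integral elements. -/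
theorem exists_generic (s : Finset E) (h0 : (0 : E) ∈ s) (hs : ∀ b ∈ s, v (i b) ≤ 1) :
    ∃ u : E, ∀ b ∈ s, v (i (u - b)) = 1 := by
  let q : Polynomial E := ∏ b ∈ s, (Polynomial.X - Polynomial.C b)
  have hq : q.Monic := Polynomial.monic_prod_of_monic _ _ fun b _ => Polynomial.monic_X_sub_C b
  have hdeg : 0 < q.degree := by
    rw [Polynomial.degree_prod]
    simp only [Polynomial.degree_X_sub_C, Finset.sum_const, nsmul_one]
    exact_mod_cast Finset.card_pos.2 ⟨0, h0⟩
  -- From `q(u) = 1` the values of the factors `u - b` multiply to `1`. This forces `u` to be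
  -- integral, so all factors are at most `1` and hence equal to `1`.
  obtain ⟨u, hu⟩ := IsAlgClosed.exists_root (q - Polynomial.C 1) (by
    rw [Polynomial.degree_sub_C hdeg]
    exact hdeg.ne')
  have hprod : ∏ b ∈ s, v (i (u - b)) = 1 := by
    have : q.eval u = 1 := by simpa [sub_eq_zero] using hu
    rw [← map_prod, ← map_prod, ← v.map_one, ← i.map_one, ← this, Polynomial.eval_prod]
    simp
  have hu1 : v (i u) ≤ 1 := by
    by_contra hlt
    rw [not_le] at hlt
    have : ∀ b ∈ s, v (i (u - b)) = v (i u) := by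
      intro b hb
      rw [map_sub, v.map_sub_eq_of_lt_left ((hs b hb).trans_lt hlt)]
    rw [Finset.prod_eq_pow_card this] at hprod
    exact (one_lt_pow' hlt (Finset.card_ne_zero_of_mem h0)).ne' hprod
  have hle : ∀ b ∈ s, v (i (u - b)) ≤ 1 := fun b hb => by
    rw [map_sub]
    exact (v.map_sub _ _).trans (max_le hu1 (hs b hb))
  exact ⟨u, (Finset.prod_eq_one_iff_of_le_one' hle).1 hprod⟩

/-- Position with respect to finitely many values is realized by a value. -/
theorem exists_value_same_position (hv : ∃ e : E, e ≠ 0 ∧ v (i e) < 1) (s : Finset E) {t : Γ₀}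
    (ht : t ≠ 0) : ∃ d : E, d ≠ 0 ∧
      ∀ c ∈ s, (t ≤ v (i c) ↔ v (i d) ≤ v (i c)) ∧ (t < v (i c) ↔ v (i d) < v (i c)) := by
  classical
  by_cases hex : ∃ c ∈ s, v (i c) = t
  · obtain ⟨c, -, hc⟩ := hex
    refine ⟨c, ?_, fun b _ => by rw [hc]; exact ⟨Iff.rfl, Iff.rfl⟩⟩
    rintro rfl
    simp at hc
    exact ht hc.symm
  push Not at hex
  suffices h : ∃ d : E, d ≠ 0 ∧ (∀ c ∈ s, v (i c) < t → v (i c) < v (i d)) ∧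
      (∀ c ∈ s, t < v (i c) → v (i d) < v (i c)) by
    obtain ⟨d, hd, h1, h2⟩ := h
    refine ⟨d, hd, fun c hc => ?_⟩
    rcases lt_or_gt_of_ne (hex c hc) with h | h
    · exact ⟨iff_of_false (not_le.2 h) (not_le.2 (h1 c hc h)),
        iff_of_false (not_lt.2 h.le) (not_lt.2 (h1 c hc h).le)⟩
    · exact ⟨iff_of_true h.le (h2 c hc h).le, iff_of_true h (h2 c hc h)⟩
  obtain ⟨e, he, hve⟩ := hv
  have hve0 : 0 < v (i e) := zero_lt_iff.2 (by simpa using he)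
  obtain ⟨l, hl, hlmax⟩ := ((insert 0 s).filter fun c => v (i c) < t).exists_max_image
    (fun c => v (i c)) ⟨0, by simpa using zero_lt_iff.2 ht⟩
  have hlt : v (i l) < t := (Finset.mem_filter.1 hl).2
  have hlmax' : ∀ c ∈ s, v (i c) < t → v (i c) ≤ v (i l) := fun c hc h =>
    hlmax c (Finset.mem_filter.2 ⟨Finset.mem_insert_of_mem hc, h⟩)
  rcases (s.filter fun c => t < v (i c)).eq_empty_or_nonempty with hU | hU
  · have hno : ∀ c ∈ s, ¬ t < v (i c) := fun c hc h =>
      Finset.eq_empty_iff_forall_notMem.1 hU c (Finset.mem_filter.2 ⟨hc, h⟩)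
    by_cases hl0 : l = 0
    · refine ⟨1, one_ne_zero, fun c hc h => ?_, fun c hc h => absurd h (hno c hc)⟩
      refine (hlmax' c hc h).trans_lt ?_
      simp [hl0]
    · refine ⟨l / e, div_ne_zero hl0 he, fun c hc h => ?_, fun c hc h => absurd h (hno c hc)⟩
      refine (hlmax' c hc h).trans_lt ?_
      rw [map_div₀, map_div₀, lt_div_iff₀ hve0]
      exact mul_lt_of_lt_one_right (zero_lt_iff.2 (by simpa using hl0)) hve
  · obtain ⟨u, hu, humin⟩ := (s.filter fun c => t < v (i c)).exists_min_image
      (fun c => v (i c)) hU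
    have hut : t < v (i u) := (Finset.mem_filter.1 hu).2
    have hu0 : 0 < v (i u) := (zero_lt_iff.2 ht).trans hut
    have hun : u ≠ 0 := by
      rintro rfl
      simp at hu0
    have humin' : ∀ c ∈ s, t < v (i c) → v (i u) ≤ v (i c) := fun c hc h =>
      humin c (Finset.mem_filter.2 ⟨hc, h⟩)
    suffices h : ∃ d : E, d ≠ 0 ∧ v (i l) < v (i d) ∧ v (i d) < v (i u) by
      obtain ⟨d, hd, h1, h2⟩ := h
      exact ⟨d, hd, fun c hc h => (hlmax' c hc h).trans_lt h1,
        fun c hc h => h2.trans_le (humin' c hc h)⟩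
    by_cases hl0 : l = 0
    · refine ⟨u * e, mul_ne_zero hun he, ?_, ?_⟩
      · rw [hl0, map_zero, map_zero, map_mul, map_mul]
        exact mul_pos hu0 hve0
      · rw [map_mul, map_mul]
        exact mul_lt_of_lt_one_right hu0 hve
    -- A square root supplies the geometric mean, strictly between the neighbouring values.
    · obtain ⟨d, hd⟩ := IsAlgClosed.exists_pow_nat_eq (l * u) two_pos
      have hd' : v (i d) ^ 2 = v (i l) * v (i u) := by
        rw [← map_pow, ← map_pow, hd, map_mul, map_mul]
      have hlv : 0 < v (i l) := zero_lt_iff.2 (by simpa using hl0)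
      have hlu := hlt.trans hut
      refine ⟨d, ?_, ?_, ?_⟩
      · rintro rfl
        simp [hl0, hun] at hd
      · rw [← pow_lt_pow_iff_left₀ zero_le zero_le two_ne_zero, hd', sq]
        exact mul_lt_mul_of_pos_left hlu hlv
      · rw [← pow_lt_pow_iff_left₀ zero_le zero_le two_ne_zero, hd', sq]
        exact mul_lt_mul_of_pos_right hlu hu0

/-- A finite configuration of balls over `E` met by a point of `M` is met by a point of `E`. -/
theorem exists_same_balls (hv : ∃ e : E, e ≠ 0 ∧ v (i e) < 1)
    (s : Finset ((E × E) ⊕ (E × E))) (x : M) :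
    ∃ y : E, ∀ k ∈ s, (x ∈ ballFamily v i k ↔ i y ∈ ballFamily v i k) := by
  classical
  let C : Finset (E × E) := s.image (Sum.elim id id)
  suffices h : ∃ y : E, ∀ p ∈ C, (v (x - i p.1) ≤ v (i p.2) ↔ v (i y - i p.1) ≤ v (i p.2)) ∧
      (v (x - i p.1) < v (i p.2) ↔ v (i y - i p.1) < v (i p.2)) by
    obtain ⟨y, hy⟩ := h
    refine ⟨y, ?_⟩
    rintro (p | p) hp
    · exact (hy p (Finset.mem_image.2 ⟨_, hp, rfl⟩)).1
    · exact (hy p (Finset.mem_image.2 ⟨_, hp, rfl⟩)).2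
  obtain ⟨r, hr, hmin⟩ := (insert 0 (C.image Prod.fst)).exists_min_image (fun ρ => v (x - i ρ))
    (Finset.insert_nonempty _ _)
  by_cases ht : v (x - i r) = 0
  · have : x = i r := by simpa [sub_eq_zero] using ht
    exact ⟨r, fun p _ => by rw [this]; exact ⟨Iff.rfl, Iff.rfl⟩⟩
  obtain ⟨d, hd, hdpos⟩ := exists_value_same_position v i hv (C.image Prod.snd) ht
  have hvd : 0 < v (i d) := zero_lt_iff.2 (by simpa using hd)
  -- The point will be `r + d * u`. Genericity of `u` against `0` and the rescaled centres prevents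
  -- cancellation, so its distance to a centre `a` is the maximum of the values of `d` and `r - a`,
  -- just as for `x` with `v (x - i r)` in place of the value of `d`.
  obtain ⟨u, hu⟩ := exists_generic v i (insert 0
    (((C.image Prod.fst).image fun a => (a - r) / d).filter fun b => v (i b) ≤ 1))
    (Finset.mem_insert_self _ _) (by
      intro b hb
      rcases Finset.mem_insert.1 hb with rfl | hb
      · simp
      · exact (Finset.mem_filter.1 hb).2)
  have hu1 : v (i u) = 1 := by simpa using hu 0 (Finset.mem_insert_self _ _)
  have hyr : v (i (r + d * u) - i r) = v (i d) := by simp [hu1]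
  refine ⟨r + d * u, fun p hp => ?_⟩
  have hp1 : p.1 ∈ C.image Prod.fst := Finset.mem_image_of_mem _ hp
  have hya : v (i (r + d * u) - i p.1) = max (v (i d)) (v (i r - i p.1)) := by
    by_cases hle : v (i r - i p.1) ≤ v (i d)
    · have hb : v (i ((p.1 - r) / d)) ≤ 1 := by
        rw [map_div₀, map_div₀, div_le_one₀ hvd, map_sub, v.map_sub_swap]
        exact hle
      have h1 := hu _ (Finset.mem_insert_of_mem (Finset.mem_filter.2
        ⟨Finset.mem_image_of_mem (fun a => (a - r) / d) hp1, hb⟩))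
      have : i (r + d * u) - i p.1 = i d * i (u - (p.1 - r) / d) := by
        rw [← map_sub, ← map_mul]
        congr 1
        field_simp
        ring
      rw [this, map_mul, h1, mul_one, max_eq_left hle]
    · have : i (r + d * u) - i p.1 = i (d * u) + (i r - i p.1) := by
        simp only [map_add]
        ring
      rw [this, v.map_add_of_distinct_val]
      · simp [hu1]
      · simp only [map_mul, hu1, mul_one]
        exact (not_le.1 hle).ne
  have hxa : v (x - i p.1) = max (v (x - i r)) (v (i r - i p.1)) :=
    map_sub_eq_max v (hmin _ (Finset.mem_insert_of_mem hp1))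
  have := hdpos p.2 (Finset.mem_image_of_mem _ hp)
  rw [hya, hxa, max_le_iff, max_le_iff, max_lt_iff, max_lt_iff, this.1, this.2]
  exact ⟨Iff.rfl, Iff.rfl⟩

/-- Finitely many comparisons of values of polynomials over `E` that hold or fail at a point of
`M` do so at a point of `E`. -/
theorem exists_same_comparisons (hv : ∃ e : E, e ≠ 0 ∧ v (i e) < 1)
    (s : Finset (Polynomial E × Polynomial E)) (x : M) :
    ∃ y : E, ∀ p ∈ s, (v (p.1.eval₂ i x) ≤ v (p.2.eval₂ i x) ↔
      v (i (p.1.eval y)) ≤ v (i (p.2.eval y))) := by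
  classical
  choose t ht using fun p : Polynomial E × Polynomial E => finDet_polynomial v i p.1 p.2
  obtain ⟨y, hy⟩ := exists_same_balls v i hv (s.biUnion t) x
  refine ⟨y, fun p hp => ?_⟩
  rw [← Polynomial.eval₂_at_apply, ← Polynomial.eval₂_at_apply]
  exact ⟨ht p x (i y) fun k hk => hy k (Finset.mem_biUnion.2 ⟨p, hp, hk⟩),
    ht p (i y) x fun k hk => (hy k (Finset.mem_biUnion.2 ⟨p, hp, hk⟩)).symm⟩

end Balls

/-! ### Conjugacy of valuation rings in algebraic extensions -/

section Conjugacy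

variable {F E : Type*} [Field F] [Field E] [Algebra F E]

/-- Over the integral closure of a valuation ring, every algebraic element is a fraction at a
given prime, or its inverse is. -/
theorem exists_fraction_of_aeval_eq_zero {B : Subring E} (hB : ∀ x : E, IsIntegral B x → x ∈ B)
    (P : Ideal B) (x : E) (n : ℕ) (f : Polynomial B) (hn : f.natDegree ≤ n)
    (hf : Polynomial.aeval x f = 0) (hfP : ∃ k, f.coeff k ∉ P) :
    ∃ p s : B, s ∉ P ∧ (x * s = p ∨ x * p = s) := by
  induction n generalizing f with
  | zero =>
    obtain ⟨k, hk⟩ := hfP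
    have hf0 := Polynomial.eq_C_of_natDegree_le_zero hn
    rw [hf0, Polynomial.aeval_C] at hf
    have : f.coeff 0 = 0 := Subtype.ext hf
    rw [hf0, this] at hk
    simp at hk
  | succ n ih =>
    by_cases hd : f.natDegree ≤ n
    · exact ih f hd hf hfP
    have hdeg : f.natDegree = n + 1 := le_antisymm hn (by omega)
    have hint := isIntegral_leadingCoeff_smul f x hf
    have hb := hB _ hint
    set a := f.leadingCoeff with ha
    set b : B := ⟨a • x, hb⟩ with hbdef
    have hxa : x * a = b := by
      rw [hbdef]
      change x * a = a • x
      rw [Algebra.smul_def, mul_comm]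
      rfl
    by_cases haP : a ∈ P
    · by_cases hbP : b ∈ P
      · have hcoeff : f.coeff (n + 1) = a := by rw [ha, Polynomial.leadingCoeff, hdeg]
        -- Since `x * a = b`, the leading term can be folded into degree `n`. As `a` and `b` lie in
        -- `P`, a coefficient outside `P` survives.
        refine ih (f.eraseLead + Polynomial.C b * Polynomial.X ^ n) ?_ ?_ ?_
        · refine (Polynomial.natDegree_add_le _ _).trans (max_le ?_ ?_)
          · have := Polynomial.eraseLead_natDegree_le f
            omega
          · exact Polynomial.natDegree_C_mul_X_pow_le _ _
        · have h1 := congrArg (Polynomial.aeval x) f.eraseLead_add_C_mul_X_pow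
          rw [hf, map_add, hdeg, ← ha] at h1
          rw [map_add, ← h1]
          congr 1
          simp only [map_mul, Polynomial.aeval_C, map_pow, Polynomial.aeval_X]
          have : (algebraMap B E) b = x * a := hxa.symm
          rw [this]
          change x * (a : E) * x ^ n = (a : E) * x ^ (n + 1)
          ring
        · obtain ⟨k, hk⟩ := hfP
          have hk' : k ≠ n + 1 := by
            rintro rfl
            exact hk (hcoeff ▸ haP)
          refine ⟨k, fun hmem => hk ?_⟩
          rw [Polynomial.coeff_add, Polynomial.eraseLead_coeff_of_ne _ (by rwa [hdeg])] at hmem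
          refine (Ideal.add_mem_iff_left _ ?_).1 hmem
          rw [Polynomial.coeff_C_mul]
          exact P.mul_mem_right _ hbP
      · exact ⟨a, b, hbP, Or.inr hxa⟩
    · exact ⟨b, a, haP, Or.inl hxa⟩

/-- An algebraic element over the fraction field of a valuation ring is a root of a polynomial
with coefficients in the valuation ring, one of which is `1`. -/
theorem exists_primitive_polynomial (V : ValuationSubring F) {x : E} (hx : IsAlgebraic F x) :
    ∃ f : Polynomial F, (∀ k, f.coeff k ∈ V) ∧ (∃ k, f.coeff k = 1) ∧
      Polynomial.aeval x f = 0 := by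
  obtain ⟨g, hg0, hg⟩ := hx
  obtain ⟨k, hk, hmax⟩ := g.support.exists_max_image (fun k => V.valuation (g.coeff k))
    (Polynomial.support_nonempty.2 hg0)
  have hk0 : g.coeff k ≠ 0 := Polynomial.mem_support_iff.1 hk
  refine ⟨Polynomial.C (g.coeff k)⁻¹ * g, fun l => ?_, ⟨k, ?_⟩, ?_⟩
  · rw [Polynomial.coeff_C_mul, ← V.valuation_le_one_iff, map_mul, map_inv₀]
    have hpos : 0 < V.valuation (g.coeff k) := zero_lt_iff.2 (by simpa using hk0)
    rw [inv_mul_le_one₀ hpos]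
    by_cases hl : g.coeff l = 0
    · simp [hl]
    · exact hmax l (Polynomial.mem_support_iff.2 hl)
  · rw [Polynomial.coeff_C_mul, inv_mul_cancel₀ hk0]
  · simp [hg]

theorem isIntegral_mem_of_comap_le (V : ValuationSubring F) (W : ValuationSubring E)
    (h : ∀ a ∈ V, algebraMap F E a ∈ W) {x : E} (hx : IsIntegral V x) : x ∈ W := by
  obtain ⟨p, hp, hpx⟩ := hx
  let φ : V →+* W := ((algebraMap F E).comp V.subtype).codRestrict W.toSubring
    fun a => h a a.2
  have : IsIntegral W x := ⟨p.map φ, hp.map φ, by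
    rw [Polynomial.eval₂_map]
    exact hpx⟩
  obtain ⟨y, rfl⟩ := IsIntegrallyClosed.isIntegral_iff.1 this
  exact y.2

/-- Valuation rings of an algebraic extension over the same valuation ring are determined by their
maximal ideals on the integral closure. -/
theorem le_of_nonunits_integral_iff [Algebra.IsAlgebraic F E] {V : ValuationSubring F}
    {W₁ W₂ : ValuationSubring E}
    (h₁ : ∀ a ∈ V, algebraMap F E a ∈ W₁) (h₂ : ∀ a ∈ V, algebraMap F E a ∈ W₂)
    (h : ∀ x : E, IsIntegral V x → (W₁.valuation x < 1 ↔ W₂.valuation x < 1)) : W₁ ≤ W₂ := by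
  intro x hx
  let B : Subring E := (integralClosure V E).toSubring
  have hB : ∀ x : E, IsIntegral B x → x ∈ B := fun y hy =>
    isIntegral_trans (R := V) (A := integralClosure V E) y hy
  let φ : B →+* W₁ := B.subtype.codRestrict W₁.toSubring
    fun b => isIntegral_mem_of_comap_le V W₁ h₁ b.2
  let P : Ideal B := (IsLocalRing.maximalIdeal W₁).comap φ
  have hPmem : ∀ b : B, b ∈ P ↔ W₁.valuation b < 1 := fun b => by
    rw [Ideal.mem_comap, ValuationSubring.valuation_lt_one_iff]
    rfl
  obtain ⟨f, hfV, ⟨k, hk⟩, hfx⟩ := exists_primitive_polynomial V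
    (Algebra.IsAlgebraic.isAlgebraic (R := F) x)
  have hfl : f ∈ Polynomial.lifts V.subtype := by
    rw [Polynomial.lifts_iff_coeff_lifts]
    exact fun l => ⟨⟨_, hfV l⟩, rfl⟩
  obtain ⟨g, rfl⟩ := hfl
  let ψ : V →+* B := ((algebraMap F E).comp V.subtype).codRestrict B
    fun a => isIntegral_algebraMap (R := V) (x := a)
  -- Elements of `B` outside `P` are units in both rings. If `x = p / s`, this suffices; if `x = s /
  -- p`, then `x ∈ W₁` forces `p` outside `P` too.
  obtain ⟨p, s, hs, hps⟩ := exists_fraction_of_aeval_eq_zero hB P x _ (g.map ψ) le_rfl (by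
    rw [Polynomial.aeval_def, Polynomial.eval₂_map]
    rw [Polynomial.aeval_def, Polynomial.coe_mapRingHom, Polynomial.eval₂_map] at hfx
    exact hfx) ⟨k, by
      have : g.coeff k = 1 := Subtype.ext (by simpa using hk)
      rw [Polynomial.coeff_map, this, map_one, hPmem]
      simp⟩
  rw [hPmem] at hs
  have hle₂ : ∀ b : B, W₂.valuation b ≤ 1 := fun b =>
    (W₂.valuation_le_one_iff _).2 (isIntegral_mem_of_comap_le V W₂ h₂ b.2)
  have hle₁ : ∀ b : B, W₁.valuation b ≤ 1 := fun b =>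
    (W₁.valuation_le_one_iff _).2 (isIntegral_mem_of_comap_le V W₁ h₁ b.2)
  have hunit : ∀ b : B, ¬ W₁.valuation b < 1 → W₂.valuation b = 1 := fun b hb =>
    le_antisymm (hle₂ b) (not_lt.1 fun hlt => hb ((h b b.2).2 hlt))
  rw [← W₂.valuation_le_one_iff]
  rcases hps with e | e
  · have := congrArg W₂.valuation e
    rw [map_mul, hunit s hs, mul_one] at this
    rw [this]
    exact hle₂ p
  · have hp : ¬ W₁.valuation p < 1 := fun hlt => hs (by
      rw [← e, map_mul]
      exact mul_lt_one_of_nonneg_of_lt_one_right ((W₁.valuation_le_one_iff _).2 hx) zero_le hlt)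
    have := congrArg W₂.valuation e
    rw [map_mul, hunit p hp, mul_one] at this
    rw [this]
    exact hle₂ s

/-- The Galois group permutes transitively the primes of the integral closure of `V` over a given
prime, and each valuation ring is recovered from its prime by `le_of_nonunits_integral_iff`. -/
theorem comap_algEquiv_eq_of_isGalois [IsGalois F E] {W₁ W₂ : ValuationSubring E}
    (h : W₁.comap (algebraMap F E) = W₂.comap (algebraMap F E)) :
    ∃ σ : E ≃ₐ[F] E, W₂.comap (σ : E →+* E) = W₁ := by
  set V := W₁.comap (algebraMap F E) with hV
  have h₁ : ∀ a ∈ V, algebraMap F E a ∈ W₁ := fun a ha => ha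
  have h₂ : ∀ a ∈ V, algebraMap F E a ∈ W₂ := fun a ha => by
    rw [h] at ha
    exact ha
  let B := integralClosure V E
  have hideal : ∀ W : ValuationSubring E, (∀ a ∈ V, algebraMap F E a ∈ W) →
      ∃ P : Ideal B, P.IsPrime ∧ ∀ b : B, b ∈ P ↔ W.valuation b < 1 := by
    intro W hW
    let φ : B →+* W := (B.val : B →+* E).codRestrict W.toSubring
      fun b => isIntegral_mem_of_comap_le V W hW b.2
    refine ⟨(IsLocalRing.maximalIdeal W).comap φ, inferInstance, fun b => ?_⟩
    rw [Ideal.mem_comap, ValuationSubring.valuation_lt_one_iff]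
    rfl
  obtain ⟨P₁, hP₁, hm₁⟩ := hideal W₁ h₁
  obtain ⟨P₂, hP₂, hm₂⟩ := hideal W₂ h₂
  have hunder : P₁.under V = P₂.under V := by
    ext a
    rw [Ideal.under_def, Ideal.under_def, Ideal.mem_comap, Ideal.mem_comap, hm₁, hm₂]
    change W₁.valuation (algebraMap F E a) < 1 ↔ W₂.valuation (algebraMap F E a) < 1
    rw [← ValuationSubring.mem_nonunits_iff, ← ValuationSubring.mem_nonunits_iff,
      ValuationSubring.mem_nonunits_iff_or, ValuationSubring.mem_nonunits_iff_or, ← map_inv₀]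
    rw [← ValuationSubring.mem_comap, ← ValuationSubring.mem_comap, ← h, ← hV]
  have hinv : Algebra.IsInvariant V B (E ≃ₐ[F] E) := by
    refine ⟨fun b hb => ?_⟩
    have : ∀ σ : E ≃ₐ[F] E, σ (b : E) = b := fun σ => congrArg Subtype.val (hb σ)
    obtain ⟨a, ha⟩ := (InfiniteGalois.mem_range_algebraMap_iff_fixed (k := F) (b : E)).2 this
    have hint : IsIntegral V (algebraMap F E a) := by
      have hb := b.2
      rw [show (b : E) = algebraMap F E a from ha.symm] at hb
      exact hb
    have haV : a ∈ V := isIntegral_mem_of_comap_le V W₁ h₁ hint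
    exact ⟨⟨a, haV⟩, Subtype.ext ha⟩
  -- Integral elements have open stabilizers, so the action on discrete `B` is continuous and the
  -- profinite transitivity theorem covers infinite extensions.
  let : TopologicalSpace B := ⊥
  have : DiscreteTopology B := ⟨rfl⟩
  have : ContinuousSMul (E ≃ₐ[F] E) B := by
    rw [continuousSMul_iff_stabilizer_isOpen]
    intro b
    convert! stabilizer_isOpen_of_isIntegral (K := F) (b : E) using 2
    ext σ
    exact Subtype.ext_iff
  obtain ⟨σ, hσ⟩ := Algebra.IsInvariant.exists_smul_of_under_eq_of_profinite
    (A := V) (G := E ≃ₐ[F] E) P₁ P₂ hunder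
  refine ⟨σ, ?_⟩
  have hcomap : ∀ a ∈ V, algebraMap F E a ∈ W₂.comap (σ : E →+* E) := fun a ha => by
    rw [ValuationSubring.mem_comap]
    simpa using h₂ a ha
  have hval : ∀ (W : ValuationSubring E) (x : E),
      (W.comap (σ : E →+* E)).valuation x < 1 ↔ W.valuation (σ x) < 1 := by
    intro W x
    rw [← ValuationSubring.mem_nonunits_iff, ← ValuationSubring.mem_nonunits_iff,
      ValuationSubring.mem_nonunits_iff_or, ValuationSubring.mem_nonunits_iff_or]
    simp
  have key : ∀ x : E, IsIntegral V x →
      ((W₂.comap (σ : E →+* E)).valuation x < 1 ↔ W₁.valuation x < 1) := by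
    intro x hx
    rw [hval]
    have := hm₂ (σ • (⟨x, hx⟩ : B))
    rw [hσ, Ideal.smul_mem_pointwise_smul_iff, hm₁] at this
    exact this.symm
  exact le_antisymm (le_of_nonunits_integral_iff hcomap h₁ key)
    (le_of_nonunits_integral_iff h₁ hcomap fun x hx => (key x hx).symm)

theorem mem_iff_pow_mem (W : ValuationSubring E) {x : E} {n : ℕ} (hn : n ≠ 0) :
    x ^ n ∈ W ↔ x ∈ W := by
  rw [← W.valuation_le_one_iff, ← W.valuation_le_one_iff, map_pow,
    pow_le_one_iff_of_nonneg zero_le hn]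

/-- Valuation rings of an algebraically closed field that is algebraic over `F` are conjugate over
`F` if they have the same restriction to `F`. -/
theorem comap_algEquiv_eq_of_isAlgClosed [IsAlgClosed E] [Algebra.IsAlgebraic F E]
    {W₁ W₂ : ValuationSubring E}
    (h : W₁.comap (algebraMap F E) = W₂.comap (algebraMap F E)) :
    ∃ σ : E ≃ₐ[F] E, W₂.comap (σ : E →+* E) = W₁ := by
  have : Algebra.IsAlgebraic (perfectClosure F E) E := Algebra.IsAlgebraic.tower_top (K := F) _
  have : IsAlgClosure (perfectClosure F E) E := ⟨inferInstance, inferInstance⟩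
  have : Algebra.IsSeparable (perfectClosure F E) E := inferInstance
  have : IsGalois (perfectClosure F E) E := ⟨⟩
  obtain ⟨σ, hσ⟩ := comap_algEquiv_eq_of_isGalois (F := perfectClosure F E)
    (W₁ := W₁) (W₂ := W₂) (by
    ext ⟨x, hx⟩
    -- Passing to the perfect closure makes `E` Galois; a power of `x` lies in `F`, so the two
    -- restrictions still agree there.
    obtain ⟨n, y, hy⟩ := mem_perfectClosure_iff.1 hx
    have hq : ringExpChar F ^ n ≠ 0 := pow_ne_zero _ (expChar_pos F _).ne'
    simp only [ValuationSubring.mem_comap]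
    change x ∈ W₁ ↔ x ∈ W₂
    rw [← mem_iff_pow_mem W₁ hq, ← mem_iff_pow_mem W₂ hq, ← hy, ← ValuationSubring.mem_comap,
      ← ValuationSubring.mem_comap, h])
  exact ⟨σ.restrictScalars F, hσ⟩

end Conjugacy

/-! ### Extending quantifier-free types by one element -/

section SameType

theorem exists_lift_algebraicClosure {F M : Type*} [Field F] [Field M] [IsAlgClosed M]
    (i : F →+* M) : ∃ j : AlgebraicClosure F →+* M, j.comp (algebraMap F _) = i := by
  let : Algebra F M := i.toAlgebra
  exact ⟨(IsAlgClosed.lift : AlgebraicClosure F →ₐ[F] M), RingHom.ext fun x =>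
    (IsAlgClosed.lift : AlgebraicClosure F →ₐ[F] M).commutes x⟩

theorem valuation_le_iff_of_comap_eq {E M N : Type*} [Field E] [Field M] [Field N]
    {O : ValuationSubring M} {O' : ValuationSubring N} {i : E →+* M} {j : E →+* N}
    (h : O.comap i = O'.comap j) (x y : E) :
    O.valuation (i x) ≤ O.valuation (i y) ↔ O'.valuation (j x) ≤ O'.valuation (j y) := by
  by_cases hy : y = 0
  · simp [hy]
  have hM : 0 < O.valuation (i y) := zero_lt_iff.2 (by simpa using hy)
  have hN : 0 < O'.valuation (j y) := zero_lt_iff.2 (by simpa using hy)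
  rw [← div_le_one₀ hM, ← div_le_one₀ hN, ← map_div₀, ← map_div₀, ← map_div₀, ← map_div₀,
    O.valuation_le_one_iff, O'.valuation_le_one_iff, ← ValuationSubring.mem_comap, h,
    ValuationSubring.mem_comap]

variable {k M ι : Type*} [Field k] [Field M] [IsAlgClosed M]

/-- Two tuples of an algebraically closed valued field with the same quantifier-free type over a
non-trivially valued subfield satisfy the same existential formulas in one variable. -/
theorem exists_same_type (O : ValuationSubring M) (κ : k →+* M)
    (hk : ∃ e : k, e ≠ 0 ∧ O.valuation (κ e) < 1) (a b : ι → M)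
    (hab : ∀ f g : MvPolynomial ι k,
      (O.valuation (f.eval₂ κ a) ≤ O.valuation (g.eval₂ κ a) ↔
        O.valuation (f.eval₂ κ b) ≤ O.valuation (g.eval₂ κ b)))
    (s : Finset (MvPolynomial (Option ι) k × MvPolynomial (Option ι) k)) (w : M) :
    ∃ w' : M, ∀ p ∈ s,
      (O.valuation (p.1.eval₂ κ fun o => o.elim w a) ≤
          O.valuation (p.2.eval₂ κ fun o => o.elim w a) ↔
        O.valuation (p.1.eval₂ κ fun o => o.elim w' b) ≤
          O.valuation (p.2.eval₂ κ fun o => o.elim w' b)) := by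
  classical
  let evA : MvPolynomial ι k →+* M := MvPolynomial.eval₂Hom κ a
  let evB : MvPolynomial ι k →+* M := MvPolynomial.eval₂Hom κ b
  -- Comparison with the zero polynomial expresses vanishing.
  have hker : RingHom.ker evA = RingHom.ker evB := by
    ext f
    have := hab f 0
    simpa [RingHom.mem_ker, evA, evB] using this
  let R := MvPolynomial ι k ⧸ RingHom.ker evA
  have : (RingHom.ker evA).IsPrime := RingHom.ker_isPrime evA
  let φA : R →+* M := RingHom.kerLift evA
  let φB : R →+* M := Ideal.Quotient.lift (RingHom.ker evA) evB fun f hf => by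
    rw [hker] at hf
    exact hf
  have hφA : Function.Injective φA := RingHom.kerLift_injective evA
  have hφB : Function.Injective φB := by
    rw [injective_iff_map_eq_zero]
    intro x hx
    obtain ⟨f, rfl⟩ := Ideal.Quotient.mk_surjective x
    rw [Ideal.Quotient.eq_zero_iff_mem, hker]
    exact hx
  let F := FractionRing R
  let iA : F →+* M := IsFractionRing.lift hφA
  let iB : F →+* M := IsFractionRing.lift hφB
  have hF : O.comap iA = O.comap iB := by
    ext x
    obtain ⟨p, q, hq, rfl⟩ := IsFractionRing.div_surjective R x
    have hq0 : q ≠ 0 := nonZeroDivisors.ne_zero hq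
    obtain ⟨f, rfl⟩ := Ideal.Quotient.mk_surjective p
    obtain ⟨g, rfl⟩ := Ideal.Quotient.mk_surjective q
    have hgA : 0 < O.valuation (evA g) := zero_lt_iff.2
      ((Valuation.ne_zero_iff _).2 ((map_ne_zero_iff φA hφA).2 hq0))
    have hgB : 0 < O.valuation (evB g) := zero_lt_iff.2
      ((Valuation.ne_zero_iff _).2 ((map_ne_zero_iff φB hφB).2 hq0))
    have hA : iA (algebraMap R F (Ideal.Quotient.mk _ f) / algebraMap R F (Ideal.Quotient.mk _ g))
        = evA f / evA g := by
      rw [map_div₀, IsFractionRing.lift_algebraMap, IsFractionRing.lift_algebraMap]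
      rfl
    have hB : iB (algebraMap R F (Ideal.Quotient.mk _ f) / algebraMap R F (Ideal.Quotient.mk _ g))
        = evB f / evB g := by
      rw [map_div₀, IsFractionRing.lift_algebraMap, IsFractionRing.lift_algebraMap]
      rfl
    rw [ValuationSubring.mem_comap, ValuationSubring.mem_comap, hA, hB,
      ← O.valuation_le_one_iff, ← O.valuation_le_one_iff, map_div₀, map_div₀, div_le_one₀ hgA,
      div_le_one₀ hgB]
    exact hab f g
  let E := AlgebraicClosure F
  obtain ⟨i, hi⟩ := exists_lift_algebraicClosure iA
  obtain ⟨j, hj⟩ := exists_lift_algebraicClosure iB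
  -- `iA` and `iB` pull `O` back to the same ring of `F`, but the chosen extensions to `E` may not;
  -- conjugacy corrects `j`.
  obtain ⟨σ, hσ⟩ := comap_algEquiv_eq_of_isAlgClosed (F := F) (E := E) (W₁ := O.comap i)
    (W₂ := O.comap j) (by
      rw [ValuationSubring.comap_comap, ValuationSubring.comap_comap, hi, hj, hF])
  let j' : E →+* M := j.comp (σ : E →+* E)
  have hj' : j'.comp (algebraMap F E) = iB := by
    rw [← hj]
    refine RingHom.ext fun x => ?_
    exact congrArg j (σ.commutes x)
  have hE : O.comap i = O.comap j' := by rw [← hσ, ValuationSubring.comap_comap]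
  let θ : MvPolynomial ι k →+* E :=
    (algebraMap F E).comp ((algebraMap R F).comp (Ideal.Quotient.mk (RingHom.ker evA)))
  have hiθ : i.comp θ = evA := by
    rw [← RingHom.comp_assoc, hi]
    refine RingHom.ext fun x => ?_
    exact IsFractionRing.lift_algebraMap hφA _
  have hjθ : j'.comp θ = evB := by
    rw [← RingHom.comp_assoc, hj']
    refine RingHom.ext fun x => ?_
    exact IsFractionRing.lift_algebraMap hφB _
  let toPoly : MvPolynomial (Option ι) k →+* Polynomial E :=
    MvPolynomial.eval₂Hom (Polynomial.C.comp (θ.comp MvPolynomial.C))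
      fun o => o.elim Polynomial.X fun l => Polynomial.C (θ (MvPolynomial.X l))
  have hpoly : ∀ (l : E →+* M) (c : ι → M) (z : M), l.comp θ = MvPolynomial.eval₂Hom κ c →
      ∀ p : MvPolynomial (Option ι) k,
        (toPoly p).eval₂ l z = p.eval₂ κ fun o => o.elim z c := by
    intro l c z hl p
    have : (Polynomial.eval₂RingHom l z).comp toPoly =
        MvPolynomial.eval₂Hom κ fun o => o.elim z c := by
      have hl' : ∀ q, l (θ q) = MvPolynomial.eval₂ κ c q := fun q => RingHom.congr_fun hl q
      ext o
      · simp [toPoly, hl']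
      · cases o <;> simp [toPoly, hl']
    exact RingHom.congr_fun this p
  have hnontriv : ∃ e : E, e ≠ 0 ∧ O.valuation (i e) < 1 := by
    obtain ⟨e, he, hve⟩ := hk
    have : i (θ (MvPolynomial.C e)) = κ e := by
      have := RingHom.congr_fun hiθ (MvPolynomial.C e)
      simpa [evA] using this
    refine ⟨θ (MvPolynomial.C e), fun h0 => he ?_, by rwa [this]⟩
    rw [h0, map_zero] at this
    exact (map_eq_zero κ).1 this.symm
  -- The element `w` need not come from `E`; it is replaced by `y` in `E`, which can be carried over
  -- to the side of `b` by `j'`.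
  obtain ⟨y, hy⟩ := exists_same_comparisons O.valuation i hnontriv
    (s.image fun p => (toPoly p.1, toPoly p.2)) w
  refine ⟨j' y, fun p hp => ?_⟩
  have := hy _ (Finset.mem_image_of_mem _ hp)
  rw [valuation_le_iff_of_comap_eq hE, ← Polynomial.eval₂_at_apply,
    ← Polynomial.eval₂_at_apply] at this
  simpa only [hpoly i a w hiθ, hpoly j' b (j' y) hjθ] using this

end SameType

/-! ### Ultrapowers of algebraically closed valued fields -/

section Ultrapower

variable {I L : Type*} [Field L] (W : Ultrafilter I)

open Filter

/-- Roots are chosen coordinate by coordinate for representatives of the coefficients of a monic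
polynomial. -/
instance isAlgClosed_germ [IsAlgClosed L] : IsAlgClosed (Germ (W : Filter I) L) := by
  refine IsAlgClosed.of_exists_root _ fun p hp hirr => ?_
  have hrep : ∀ x : Germ (W : Filter I) L, ∃ f : I → L, (f : Germ (W : Filter I) L) = x := fun x =>
    Germ.inductionOn x fun f => ⟨f, rfl⟩
  choose rep hr using hrep
  let n := p.natDegree
  have hn : 0 < n := hirr.natDegree_pos
  -- The leading term is imposed exactly, so the degree is `n` at every index and not just almost
  -- everywhere.
  let q : I → Polynomial L := fun t => Polynomial.X ^ n +
    ∑ l ∈ Finset.range n, Polynomial.C (rep (p.coeff l) t) * Polynomial.X ^ l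
  have hroot : ∀ t, ∃ z, (q t).eval z = 0 := by
    intro t
    have hlt : (∑ l ∈ Finset.range n, Polynomial.C (rep (p.coeff l) t) *
        Polynomial.X ^ l).degree < (n : WithBot ℕ) := by
      refine (Polynomial.degree_sum_le _ _).trans_lt ?_
      refine (Finset.sup_lt_iff (WithBot.bot_lt_coe n)).2 fun l hl => ?_
      exact (Polynomial.degree_C_mul_X_pow_le _ _).trans_lt
        (WithBot.coe_lt_coe.2 (Finset.mem_range.1 hl))
    have : (q t).degree = (n : WithBot ℕ) := by
      rw [Polynomial.degree_add_eq_left_of_degree_lt] <;> rw [Polynomial.degree_X_pow]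
      exact hlt
    exact IsAlgClosed.exists_root (q t) (by rw [this]; exact_mod_cast hn.ne')
  choose z hz using hroot
  refine ⟨(z : Germ (W : Filter I) L), ?_⟩
  let co : (I → L) →+* Germ (W : Filter I) L := Germ.coeRingHom (W : Filter I)
  have h1 : p.eval (co z) = co fun t => (q t).eval (z t) := by
    have : (fun t => (q t).eval (z t)) = z ^ n + ∑ l ∈ Finset.range n, rep (p.coeff l) * z ^ l := by
      ext t
      simp [q, Polynomial.eval_finsetSum]
    rw [this]
    conv_lhs => rw [hp.as_sum]
    simp only [Polynomial.eval_add, Polynomial.eval_pow, Polynomial.eval_X,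
      Polynomial.eval_finsetSum, Polynomial.eval_mul, Polynomial.eval_C, map_add, map_pow, map_sum,
      map_mul]
    congr 1
    refine Finset.sum_congr rfl fun l _ => ?_
    congr 1
    exact (hr _).symm
  have h2 : (fun t => (q t).eval (z t)) = 0 := funext hz
  rw [h2, map_zero] at h1
  exact h1

/-- The valuation ring of an ultrapower of a valued field. -/
def ultraSubring (O : ValuationSubring L) : ValuationSubring (Germ (W : Filter I) L) where
  carrier := {x | x.LiftPred (· ∈ O)}
  zero_mem' := Eventually.of_forall fun _ => O.zero_mem
  one_mem' := Eventually.of_forall fun _ => O.one_mem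
  add_mem' {x y} := Germ.inductionOn₂ x y fun f g hf hg => by
    filter_upwards [hf, hg] with t h1 h2 using O.add_mem _ _ h1 h2
  mul_mem' {x y} := Germ.inductionOn₂ x y fun f g hf hg => by
    filter_upwards [hf, hg] with t h1 h2 using O.mul_mem _ _ h1 h2
  neg_mem' {x} := Germ.inductionOn x fun f hf => by
    filter_upwards [hf] with t h1 using O.neg_mem _ h1
  mem_or_inv_mem' x := Germ.inductionOn x fun f =>
    Ultrafilter.eventually_or.1 (Eventually.of_forall fun t => O.mem_or_inv_mem (f t))

/-- Łoś's theorem for a comparison: it is witnessed by a multiplier in the valuation ring, chosen at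
each index and set to `0` where none exists. -/
theorem ultraSubring_valuation_le_iff (O : ValuationSubring L) (f g : I → L) :
    (ultraSubring W O).valuation (f : Germ (W : Filter I) L) ≤
      (ultraSubring W O).valuation (g : Germ (W : Filter I) L) ↔
    ∀ᶠ t in (W : Filter I), O.valuation (f t) ≤ O.valuation (g t) := by
  rw [ValuationSubring.valuation_le_iff]
  constructor
  · rintro ⟨⟨a, ha⟩, h⟩
    induction a using Germ.inductionOn with
    | h a =>
      have h' : ∀ᶠ t in (W : Filter I), a t * g t = f t := Germ.coe_eq.1 h
      have ha' : ∀ᶠ t in (W : Filter I), a t ∈ O := ha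
      filter_upwards [h', ha'] with t h1 h2
      exact (O.valuation_le_iff _ _).2 ⟨⟨a t, h2⟩, h1⟩
  · intro h
    have : ∀ t, ∃ a : O, O.valuation (f t) ≤ O.valuation (g t) → (a : L) * g t = f t := by
      intro t
      by_cases ht : O.valuation (f t) ≤ O.valuation (g t)
      · obtain ⟨a, ha⟩ := (O.valuation_le_iff _ _).1 ht
        exact ⟨a, fun _ => ha⟩
      · exact ⟨0, fun h => absurd h ht⟩
    choose a ha using this
    refine ⟨⟨((fun t => (a t : L) : I → L) : Germ (W : Filter I) L),
      Eventually.of_forall fun t => (a t).2⟩, Germ.coe_eq.2 ?_⟩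
    filter_upwards [h] with t ht using ha t ht

theorem eval₂_germ {ι : Type*} (x : I → ι → L) (f : MvPolynomial ι L) :
    f.eval₂ ((Germ.coeRingHom (W : Filter I)).comp (Pi.constRingHom I L))
      (fun l => ((fun t => x t l : I → L) : Germ (W : Filter I) L)) =
    ((fun t => f.eval (x t) : I → L) : Germ (W : Filter I) L) := by
  have h1 : (fun t => f.eval (x t)) = f.eval₂ (Pi.constRingHom I L) fun l t => x t l := by
    ext t
    have := MvPolynomial.eval₂_comp_left (Pi.evalRingHom (fun _ : I => L) t)
      (Pi.constRingHom I L) (fun l t => x t l) f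
    exact this.symm
  rw [h1]
  exact (MvPolynomial.eval₂_comp_left (Germ.coeRingHom (W : Filter I)) (Pi.constRingHom I L)
    (fun l t => x t l) f).symm

end Ultrapower

/-! ### Quantifier elimination for ACVF by compactness -/

section QuantifierElimination

variable {L : Type*} [Field L] (O : ValuationSubring L)

/-- The family of comparisons of values of polynomials. -/
def polyFamily (ι : Type*) : MvPolynomial ι L × MvPolynomial ι L → Set (ι → L) :=
  fun p => {z | O.valuation (p.1.eval z) ≤ O.valuation (p.2.eval z)}

/-- The germs of `x` and `y` have the same quantifier-free type over `L`, so `exists_same_type`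
applies in the ultrapower; a representative of the germ it yields works almost everywhere. -/
theorem exists_ultrapower_witness [IsAlgClosed L] (hO : ∃ e : L, e ≠ 0 ∧ O.valuation e < 1)
    {I ι : Type*} (W : Ultrafilter I) (x y : I → ι → L)
    (hxy : ∀ p, ∀ᶠ t in (W : Filter I), (x t ∈ polyFamily O ι p ↔ y t ∈ polyFamily O ι p))
    (s : Finset (MvPolynomial (Option ι) L × MvPolynomial (Option ι) L)) (w : I → L) :
    ∃ w' : I → L, ∀ᶠ t in (W : Filter I), ∀ p ∈ s,
      ((fun o : Option ι => o.elim (w t) (x t)) ∈ polyFamily O (Option ι) p ↔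
        (fun o : Option ι => o.elim (w' t) (y t)) ∈ polyFamily O (Option ι) p) := by
  let κ := (Filter.Germ.coeRingHom (R := L) (W : Filter I)).comp (Pi.constRingHom I L)
  let germ : (I → ι → L) → ι → Filter.Germ (W : Filter I) L := fun x l =>
    ((fun t => x t l : I → L) : Filter.Germ (W : Filter I) L)
  have hagree : ∀ f g : MvPolynomial ι L,
      ((ultraSubring W O).valuation (f.eval₂ κ (germ x)) ≤
          (ultraSubring W O).valuation (g.eval₂ κ (germ x)) ↔
        (ultraSubring W O).valuation (f.eval₂ κ (germ y)) ≤
          (ultraSubring W O).valuation (g.eval₂ κ (germ y))) := by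
    intro f g
    simp only [germ, κ, eval₂_germ, ultraSubring_valuation_le_iff]
    exact Filter.eventually_congr (hxy (f, g))
  have hnontriv : ∃ e : L, e ≠ 0 ∧ (ultraSubring W O).valuation (κ e) < 1 := by
    obtain ⟨e, he, hve⟩ := hO
    refine ⟨e, he, ?_⟩
    rw [← not_le, ← map_one (ultraSubring W O).valuation]
    intro hle
    obtain ⟨t, ht⟩ := ((ultraSubring_valuation_le_iff W O (fun _ => 1) (fun _ => e)).1 hle).exists
    rw [map_one] at ht
    exact absurd hve (not_lt.2 ht)
  obtain ⟨w', hw'⟩ := exists_same_type (ultraSubring W O) κ hnontriv (germ x) (germ y) hagree s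
    (w : Filter.Germ (W : Filter I) L)
  induction w' using Filter.Germ.inductionOn with
  | h w' =>
    refine ⟨w', (Filter.eventually_all_finset s).2 fun p hp => ?_⟩
    have helim : ∀ (c : I → L) (z : I → ι → L),
        (fun o : Option ι => o.elim (c : Filter.Germ (W : Filter I) L) (germ z)) =
          fun o => ((fun t => (o.elim (c t) (z t) : L) : I → L) :
            Filter.Germ (W : Filter I) L) := by
      intro c z
      ext o
      cases o <;> rfl
    have := hw' p hp
    rw [helim, helim, eval₂_germ W (fun t o => Option.elim o (w t) (x t)),
      eval₂_germ W (fun t o => Option.elim o (w t) (x t)),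
      eval₂_germ W (fun t o => Option.elim o (w' t) (y t)),
      eval₂_germ W (fun t o => Option.elim o (w' t) (y t)), ultraSubring_valuation_le_iff,
      ultraSubring_valuation_le_iff] at this
    by_cases h : ∀ᶠ t in (W : Filter I),
        (fun o : Option ι => o.elim (w t) (x t)) ∈ polyFamily O (Option ι) p
    · filter_upwards [h, this.1 h] with t h1 h2 using iff_of_true h1 h2
    · filter_upwards [Ultrafilter.eventually_not.2 h,
        Ultrafilter.eventually_not.2 fun h' => h (this.2 h')] with t h1 h2 using iff_of_false h1 h2

/-- Failure gives families `x` inside and `y` outside the projection that no comparison separates in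
the limit; transferring the witnesses for `x` puts some `y t` inside. -/
theorem finDet_projection [IsAlgClosed L] (hO : ∃ e : L, e ≠ 0 ∧ O.valuation e < 1) {ι : Type*}
    {S : Set (Option ι → L)} (hS : FinDet (polyFamily O (Option ι)) S) :
    FinDet (polyFamily O ι) {z | ∃ a, (fun o : Option ι => o.elim a z) ∈ S} := by
  by_contra hnot
  obtain ⟨W, x, y, hx, hy, hxy⟩ := exists_ultrafilter_of_not_finDet hnot
  obtain ⟨s, hs⟩ := hS
  choose w hw using hx
  obtain ⟨w', hw'⟩ := exists_ultrapower_witness O hO W x y hxy s w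
  obtain ⟨t, ht⟩ := hw'.exists
  exact hy t ⟨w' t, hs _ _ ht (hw t)⟩

end QuantifierElimination

/-! ### Definability of atomic relations -/

section ModelTheory

universe u v w

variable {𝓛 : FirstOrder.Language.{u, v}} {M : Type w} [𝓛.Structure M]

theorem definable_rel₂ {α : Type*} (R : 𝓛.Relations 2) (t₁ t₂ : 𝓛.Term (M ⊕ α)) :
    (Set.univ : Set M).Definable 𝓛 {z : α → M | Structure.RelMap R
      ![t₁.realize (Sum.elim id z), t₂.realize (Sum.elim id z)]} := by
  rw [Set.definable_iff_exists_formula_sum]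
  let r : M ⊕ α → (Set.univ : Set M) ⊕ α := Sum.map (fun a => ⟨a, trivial⟩) id
  refine ⟨R.formula₂ (t₁.relabel r) (t₂.relabel r), ?_⟩
  ext z
  have : (Sum.elim (fun a : (Set.univ : Set M) => (a : M)) z) ∘ r = Sum.elim id z := by
    ext (a | a) <;> rfl
  rw [Set.mem_ofPred_eq, Set.mem_ofPred_eq, Formula.realize_rel₂, Term.realize_relabel,
    Term.realize_relabel, this]

end ModelTheory

/-! ### From additive valuations to valuation rings -/

section Values

variable {F : Type*} {Γ : Type*} [Field F] [AddCommGroup Γ] [LinearOrder Γ] [IsOrderedAddMonoid Γ]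
  (v : AddValuation F (WithTop Γ))

theorem map_add_map_inv {x : F} (hx : x ≠ 0) : v x + v x⁻¹ = 0 := by
  rw [← v.map_mul, mul_inv_cancel₀ hx, v.map_one]

/-- The valuation ring of an additively written valuation. -/
def valuationRing : ValuationSubring F where
  carrier := {x | 0 ≤ v x}
  zero_mem' := by simp
  one_mem' := by simp
  add_mem' {x y} hx hy := (le_min hx hy).trans (v.map_add x y)
  mul_mem' {x y} hx hy := by
    change 0 ≤ v (x * y)
    rw [v.map_mul]
    exact add_nonneg hx hy
  neg_mem' {x} hx := by
    change 0 ≤ v (-x)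
    rw [v.map_neg]
    exact hx
  mem_or_inv_mem' x := by
    by_cases hx : x = 0
    · left
      simp [hx]
    by_contra h
    rw [not_or] at h
    have h1 : v x < 0 := not_le.1 h.1
    have h2 : v x⁻¹ < 0 := not_le.1 h.2
    have := add_neg_of_neg_of_nonpos h1 h2.le
    rw [map_add_map_inv v hx] at this
    exact lt_irrefl _ this

/-- The order flips because the valuation of a `ValuationSubring` is multiplicative. -/
theorem valuationRing_valuation_le_iff (x y : F) :
    (valuationRing v).valuation x ≤ (valuationRing v).valuation y ↔ v y ≤ v x := by
  by_cases hy : y = 0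
  · simp [hy]
  have hpos : 0 < (valuationRing v).valuation y := zero_lt_iff.2 (by simpa using hy)
  rw [← div_le_one₀ hpos, ← map_div₀, ValuationSubring.valuation_le_one_iff]
  change 0 ≤ v (x / y) ↔ _
  have htop : v y ≠ ⊤ := fun h => hy (v.top_iff.1 h)
  have hx : v x = v (x / y) + v y := by rw [← v.map_mul, div_mul_cancel₀ _ hy]
  rw [hx]
  constructor
  · intro h
    calc v y = 0 + v y := (zero_add _).symm
      _ ≤ _ := by gcongr
  · intro h
    refine (WithTop.add_le_add_iff_right htop).1 ?_
    rwa [zero_add]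

theorem valuationRing_valuation_lt_iff (x y : F) :
    (valuationRing v).valuation x < (valuationRing v).valuation y ↔ v y < v x := by
  rw [← not_le, ← not_le, valuationRing_valuation_le_iff]

theorem IsModel.exists_pos {v : AddValuation F (WithTop Γ)} (h : IsModel v) :
    ∃ x : F, x ≠ 0 ∧ 0 < v x := by
  obtain ⟨x, hx, hvx⟩ := h.nontrivial
  rcases lt_or_gt_of_ne hvx with h | h
  · refine ⟨x⁻¹, inv_ne_zero hx, ?_⟩
    by_contra hle
    rw [not_lt] at hle
    have := add_neg_of_neg_of_nonpos h hle
    rw [map_add_map_inv v hx] at this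
    exact lt_irrefl _ this
  · exact ⟨x, hx, h⟩

end Values

/-! ### Definable sets in models of ACVF -/

section DefinableInField

variable {F : Type*} {Γ : Type*} [Field F] [AddCommGroup Γ] [LinearOrder Γ] [IsOrderedAddMonoid Γ]
  (v : AddValuation F (WithTop Γ))

theorem exists_polynomial_of_term {ι : Type*}
    (t : letI := valuedFieldStructure v; ldiv.Term (F ⊕ ι)) :
    letI := valuedFieldStructure v
    ∃ f : MvPolynomial ι F, ∀ z : ι → F, t.realize (Sum.elim id z) = f.eval z := by
  let := valuedFieldStructure v
  induction t with
  | var x =>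
    rcases x with a | l
    · exact ⟨MvPolynomial.C a, fun z => by simp⟩
    · exact ⟨MvPolynomial.X l, fun z => by simp⟩
  | func f ts ih =>
    choose p hp using ih
    cases f with
    | add => exact ⟨p 0 + p 1, fun z => by rw [map_add, ← hp, ← hp]; rfl⟩
    | mul => exact ⟨p 0 * p 1, fun z => by rw [map_mul, ← hp, ← hp]; rfl⟩
    | neg => exact ⟨-p 0, fun z => by rw [map_neg, ← hp]; rfl⟩
    | zero => exact ⟨0, fun z => by rw [map_zero]; rfl⟩
    | one => exact ⟨1, fun z => by rw [map_one]; rfl⟩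

/-- Quantifier elimination for algebraically closed non-trivially valued fields. -/
theorem finDet_of_definable (hv : IsModel v) {α : Type} {C : Set F} {S : Set (α → F)}
    (hS : letI := valuedFieldStructure v; C.Definable ldiv S) :
    FinDet (polyFamily (valuationRing v) α) S := by
  let := valuedFieldStructure v
  have := hv.isAlgClosed
  refine definable_induction (fun ι S => FinDet (polyFamily (valuationRing v) ι) S)
    (fun ι => FinDet.empty _) (fun ι S => FinDet.compl) (fun ι S T => FinDet.inter) ?_ ?_ ?_ ?_ hS
  · intro ι κ g S h
    refine (h.preimage fun z => z ∘ g).trans fun p => ?_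
    convert! FinDet.basic (polyFamily (valuationRing v) κ)
      (MvPolynomial.rename g p.1, MvPolynomial.rename g p.2) using 1
    ext z
    simp [polyFamily, MvPolynomial.eval_rename]
  · intro ι S h
    refine finDet_projection _ ?_ h
    obtain ⟨x, hx, hvx⟩ := hv.exists_pos
    refine ⟨x, hx, ?_⟩
    rw [← map_one (valuationRing v).valuation, valuationRing_valuation_lt_iff, v.map_one]
    exact hvx
  · intro ι t₁ t₂
    obtain ⟨f₁, h₁⟩ := exists_polynomial_of_term v t₁
    obtain ⟨f₂, h₂⟩ := exists_polynomial_of_term v t₂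
    convert! FinDet.basic (polyFamily (valuationRing v) ι) (f₁ - f₂, 0) using 1
    ext z
    rw [Set.mem_ofPred_eq, h₁, h₂]
    simp [polyFamily, sub_eq_zero]
  · intro ι n R ts
    choose f hf using fun l => exists_polynomial_of_term v (ts l)
    cases R with
    | div =>
      convert! FinDet.basic (polyFamily (valuationRing v) ι) (f 1, f 0) using 1
      ext z
      rw [Set.mem_ofPred_eq]
      change v ((ts 0).realize (Sum.elim id z)) ≤ v ((ts 1).realize (Sum.elim id z)) ↔
        (valuationRing v).valuation ((f 1).eval z) ≤ (valuationRing v).valuation ((f 0).eval z)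
      rw [valuationRing_valuation_le_iff, hf, hf]

/-- The definable subsets of an algebraically closed non-trivially valued field are Boolean
combinations of balls and points. -/
theorem finDet_balls_of_definable (hv : IsModel v) {C : Set F} {S : Set (Fin 1 → F)}
    (hS : letI := valuedFieldStructure v; C.Definable ldiv S) :
    FinDet (fun k => (fun z : Fin 1 → F => z 0) ⁻¹'
      ballFamily (valuationRing v).valuation (RingHom.id F) k) S := by
  have := hv.isAlgClosed
  refine (finDet_of_definable v hv hS).trans fun p => ?_
  let toPoly : MvPolynomial (Fin 1) F →+* Polynomial F :=
    MvPolynomial.eval₂Hom Polynomial.C fun _ => Polynomial.X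
  have heval : ∀ (f : MvPolynomial (Fin 1) F) (z : Fin 1 → F),
      (toPoly f).eval₂ (RingHom.id F) (z 0) = f.eval z := by
    intro f z
    have : (Polynomial.eval₂RingHom (RingHom.id F) (z 0)).comp toPoly = MvPolynomial.eval z := by
      ext l
      · simp [toPoly]
      · simp [toPoly, Subsingleton.elim l 0]
    exact RingHom.congr_fun this f
  convert! (finDet_polynomial (valuationRing v).valuation (RingHom.id F) (toPoly p.1)
    (toPoly p.2)).preimage (fun z : Fin 1 → F => z 0) using 1
  ext z
  simp only [Set.mem_preimage, Set.mem_ofPred_eq, heval]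
  rfl

theorem definable_le_map_sub (e a : F) :
    letI := valuedFieldStructure v
    (Set.univ : Set F).Definable ldiv {z : Fin 1 → F | v e ≤ v (z 0 - a)} := by
  let := valuedFieldStructure v
  let fneg : ldiv.Functions 1 := ringFunc.neg
  let fadd : ldiv.Functions 2 := ringFunc.add
  let rdiv : ldiv.Relations 2 := DivRel.div
  have := definable_rel₂ (M := F) (α := Fin 1) rdiv (Term.var (Sum.inl e))
    (fadd.apply₂ (Term.var (Sum.inr 0)) (fneg.apply₁ (Term.var (Sum.inl a))))
  convert! this using 1
  ext z
  rw [Set.mem_ofPred_eq, sub_eq_add_neg]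
  rfl

theorem definable_lt_map_sub (e a : F) :
    letI := valuedFieldStructure v
    (Set.univ : Set F).Definable ldiv {z : Fin 1 → F | v e < v (z 0 - a)} := by
  let := valuedFieldStructure v
  let fneg : ldiv.Functions 1 := ringFunc.neg
  let fadd : ldiv.Functions 2 := ringFunc.add
  let rdiv : ldiv.Relations 2 := DivRel.div
  have := (definable_rel₂ (M := F) (α := Fin 1) rdiv
    (fadd.apply₂ (Term.var (Sum.inr 0)) (fneg.apply₁ (Term.var (Sum.inl a))))
    (Term.var (Sum.inl e))).compl
  convert! this using 1
  ext z
  rw [Set.mem_ofPred_eq, sub_eq_add_neg, ← not_le]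
  rfl

end DefinableInField

/-! ### Quantifier elimination for divisible ordered abelian groups -/

section DivisibleGroups

variable {G : Type*} [AddCommGroup G]

/-- The affine function with integer coefficients given by a constant and a linear part. -/
noncomputable def affineFun {ι : Type*} (z : ι → G) : G × (ι →₀ ℤ) →+ G :=
  (AddMonoidHom.fst G (ι →₀ ℤ)) +
    (Finsupp.linearCombination ℤ z).toAddMonoidHom.comp (AddMonoidHom.snd G (ι →₀ ℤ))

theorem affineFun_apply {ι : Type*} (z : ι → G) (p : G × (ι →₀ ℤ)) :
    affineFun z p = p.1 + Finsupp.linearCombination ℤ z p.2 := rfl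

theorem exists_zsmul_eq (hdiv : ∀ n : ℕ, n ≠ 0 → ∀ g : G, ∃ h, n • h = g) (n : ℤ) (hn : n ≠ 0)
    (g : G) : ∃ h, n • h = g := by
  obtain ⟨h, hh⟩ := hdiv n.natAbs (Int.natAbs_ne_zero.2 hn) g
  rcases Int.natAbs_eq n with e | e
  · exact ⟨h, by rw [e, natCast_zsmul, hh]⟩
  · exact ⟨-h, by rw [e, neg_smul, smul_neg, neg_neg, natCast_zsmul, hh]⟩

/-- The family of half-spaces. -/
def halfspaceFamily (G : Type*) [AddCommGroup G] [LinearOrder G] (ι : Type*) :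
    G × (ι →₀ ℤ) → Set (ι → G) :=
  fun p => {z | 0 ≤ p.1 + Finsupp.linearCombination ℤ z p.2}

variable [LinearOrder G]

theorem exists_affineFun_of_term {ι : Type*} (t : oag.Term (G ⊕ ι)) :
    ∃ p : G × (ι →₀ ℤ), ∀ z : ι → G, t.realize (Sum.elim id z) = affineFun z p := by
  induction t with
  | var x =>
    rcases x with a | l
    · exact ⟨(a, 0), fun z => by simp [affineFun_apply]⟩
    · exact ⟨(0, Finsupp.single l 1), fun z => by simp [affineFun_apply]⟩
  | func f ts ih =>
    choose p hp using ih
    cases f with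
    | add => exact ⟨p 0 + p 1, fun z => by rw [map_add, ← hp, ← hp]; rfl⟩
    | neg => exact ⟨-p 0, fun z => by rw [map_neg, ← hp]; rfl⟩
    | zero => exact ⟨0, fun z => by rw [map_zero]; rfl⟩

theorem exists_term_linearCombination {ι : Type*} (q : ι →₀ ℤ) :
    ∃ t : oag.Term (G ⊕ ι), ∀ z : ι → G,
      t.realize (Sum.elim id z) = Finsupp.linearCombination ℤ z q := by
  let fadd : oag.Functions 2 := GroupFunc.add
  let fneg : oag.Functions 1 := GroupFunc.neg
  let fzero : oag.Functions 0 := GroupFunc.zero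
  have hnat : ∀ (l : ι) (n : ℕ), ∃ t : oag.Term (G ⊕ ι), ∀ z : ι → G,
      t.realize (Sum.elim id z) = n • z l := by
    intro l n
    induction n with
    | zero => exact ⟨Term.func fzero ![], fun z => by rw [zero_smul]; rfl⟩
    | succ n ih =>
      obtain ⟨t, ht⟩ := ih
      exact ⟨fadd.apply₂ t (Term.var (Sum.inr l)), fun z => by rw [succ_nsmul, ← ht]; rfl⟩
  induction q using Finsupp.induction_linear with
  | zero => exact ⟨Term.func fzero ![], fun z => by rw [map_zero]; rfl⟩
  | add p q hp hq =>
    obtain ⟨t, ht⟩ := hp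
    obtain ⟨t', ht'⟩ := hq
    exact ⟨fadd.apply₂ t t', fun z => by rw [map_add, ← ht, ← ht']; rfl⟩
  | single l n =>
    obtain ⟨t, ht⟩ := hnat l n.natAbs
    rcases Int.natAbs_eq n with e | e
    · exact ⟨t, fun z => by
        rw [ht, Finsupp.linearCombination_single, ← natCast_zsmul, ← e]⟩
    · refine ⟨fneg.apply₁ t, fun z => ?_⟩
      rw [Finsupp.linearCombination_single, e, neg_smul, natCast_zsmul, ← ht]
      rfl

variable [IsOrderedAddMonoid G]

/-- Back-and-forth step for a dense order without endpoints: halving gives midpoints, a positive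
element gives points beyond either end. -/
theorem exists_same_cut (hdiv : ∀ n : ℕ, n ≠ 0 → ∀ g : G, ∃ h, n • h = g)
    (hpos : ∃ g : G, 0 < g) {κ : Type*} (T : Finset κ) (f f' : κ → G)
    (hff : ∀ p ∈ T, ∀ r ∈ T, (f p ≤ f r ↔ f' p ≤ f' r)) (a : G) :
    ∃ a', ∀ p ∈ T, (a ≤ f p ↔ a' ≤ f' p) ∧ (f p ≤ a ↔ f' p ≤ a') := by
  classical
  by_cases hex : ∃ r ∈ T, f r = a
  · obtain ⟨r, hr, rfl⟩ := hex
    exact ⟨f' r, fun p hp => ⟨hff r hr p hp, hff p hp r hr⟩⟩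
  push Not at hex
  suffices h : ∃ a', (∀ p ∈ T, f p < a → f' p < a') ∧ (∀ p ∈ T, a < f p → a' < f' p) by
    obtain ⟨a', h1, h2⟩ := h
    refine ⟨a', fun p hp => ?_⟩
    rcases lt_or_gt_of_ne (hex p hp) with h | h
    · exact ⟨iff_of_false (not_le.2 h) (not_le.2 (h1 p hp h)), iff_of_true h.le (h1 p hp h).le⟩
    · exact ⟨iff_of_true h.le (h2 p hp h).le, iff_of_false (not_le.2 h) (not_le.2 (h2 p hp h))⟩
  obtain ⟨g, hg⟩ := hpos
  rcases (T.filter fun p => f p < a).eq_empty_or_nonempty with hlo | hlo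
  · have hlo' : ∀ p ∈ T, ¬ f p < a := fun p hp h =>
      Finset.eq_empty_iff_forall_notMem.1 hlo p (Finset.mem_filter.2 ⟨hp, h⟩)
    rcases T.eq_empty_or_nonempty with rfl | hT
    · exact ⟨0, by simp⟩
    obtain ⟨u, hu, humin⟩ := T.exists_min_image f' hT
    exact ⟨f' u - g, fun p hp h => absurd h (hlo' p hp), fun p hp _ =>
      (sub_lt_self _ hg).trans_le (humin p hp)⟩
  obtain ⟨l, hl, hlmax⟩ := (T.filter fun p => f p < a).exists_max_image f hlo
  obtain ⟨hlT, hla⟩ := Finset.mem_filter.1 hl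
  have hl' : ∀ p ∈ T, f p < a → f' p ≤ f' l := fun p hp h =>
    (hff p hp l hlT).1 (hlmax p (Finset.mem_filter.2 ⟨hp, h⟩))
  rcases (T.filter fun p => a < f p).eq_empty_or_nonempty with hup | hup
  · have hup' : ∀ p ∈ T, ¬ a < f p := fun p hp h =>
      Finset.eq_empty_iff_forall_notMem.1 hup p (Finset.mem_filter.2 ⟨hp, h⟩)
    exact ⟨f' l + g, fun p hp h => (hl' p hp h).trans_lt (lt_add_of_pos_right _ hg),
      fun p hp h => absurd h (hup' p hp)⟩
  obtain ⟨u, hu, humin⟩ := (T.filter fun p => a < f p).exists_min_image f hup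
  obtain ⟨huT, hua⟩ := Finset.mem_filter.1 hu
  have hu' : ∀ p ∈ T, a < f p → f' u ≤ f' p := fun p hp h =>
    (hff u huT p hp).1 (humin p (Finset.mem_filter.2 ⟨hp, h⟩))
  have hlu : f' l < f' u := by
    have := (hff u huT l hlT).not.1 (not_le.2 (hla.trans hua))
    exact not_le.1 this
  obtain ⟨m, hm⟩ := hdiv 2 two_ne_zero (f' l + f' u)
  rw [two_nsmul] at hm
  have h1 : f' l < m := by
    by_contra h
    rw [not_lt] at h
    exact absurd hm (add_lt_add_of_le_of_lt h (h.trans_lt hlu)).ne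
  have h2 : m < f' u := by
    by_contra h
    rw [not_lt] at h
    exact absurd hm (add_lt_add_of_lt_of_le (hlu.trans_le h) h).ne'
  exact ⟨m, fun p hp h => (hl' p hp h).trans_lt h1, fun p hp h => h2.trans_le (hu' p hp h)⟩

theorem zero_le_zsmul_add_iff {n : ℤ} {a e l : G} (he : n • e = -l) :
    (0 < n → (0 ≤ l + n • a ↔ e ≤ a)) ∧ (n < 0 → (0 ≤ l + n • a ↔ a ≤ e)) := by
  have hl : l + n • a = n • (a - e) := by
    rw [smul_sub, he]
    abel
  constructor
  · intro hn
    rw [hl, ← sub_nonneg (a := a)]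
    constructor
    · intro h
      by_contra hlt
      rw [not_le] at hlt
      have := zsmul_lt_zsmul_right hn hlt
      simp only [smul_zero] at this
      exact absurd h (not_le.2 this)
    · exact fun h => zsmul_nonneg h hn.le
  · intro hn
    have hl' : l + n • a = (-n) • (e - a) := by
      rw [hl, neg_smul, ← smul_neg, neg_sub]
    rw [hl', ← sub_nonneg (b := a)]
    have hn' : 0 < -n := neg_pos.2 hn
    constructor
    · intro h
      by_contra hlt
      rw [not_le] at hlt
      have := zsmul_lt_zsmul_right hn' hlt
      simp only [smul_zero] at this
      exact absurd h (not_le.2 this)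
    · exact fun h => zsmul_nonneg h hn'.le

/-- Clearing denominators in `-k/m ≤ -l/n` with the factor `m² n²`, positive whatever the signs of
`m` and `n`. -/
theorem le_iff_zero_le_of_zsmul_eq {m n : ℤ} (hm : m ≠ 0) (hn : n ≠ 0) {d e k l : G}
    (hd : m • d = -k) (he : n • e = -l) :
    d ≤ e ↔ 0 ≤ (m * n ^ 2) • k - (n * m ^ 2) • l := by
  have hpos : 0 < m ^ 2 * n ^ 2 := by positivity
  have h1 : (m * n ^ 2) • k = -((m ^ 2 * n ^ 2) • d) := by
    rw [← neg_neg k, ← hd, smul_neg, smul_smul]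
    congr 2
    ring
  have h2 : (n * m ^ 2) • l = -((m ^ 2 * n ^ 2) • e) := by
    rw [← neg_neg l, ← he, smul_neg, smul_smul]
    congr 2
    ring
  have h3 : (m * n ^ 2) • k - (n * m ^ 2) • l = 0 + (m ^ 2 * n ^ 2) • (e - d) := by
    rw [h1, h2, smul_sub]
    abel
  rw [h3, (zero_le_zsmul_add_iff (e := 0) (by simp)).1 hpos, sub_nonneg]

/-- Each half-space with nonzero slope in the eliminated variable bounds it by a critical point, so
only the order of the critical points matters. That order is given by the half-spaces `diff`; those
of slope zero pass through as `rest`. -/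
theorem finDet_halfspace_projection (hdiv : ∀ n : ℕ, n ≠ 0 → ∀ g : G, ∃ h, n • h = g)
    (hpos : ∃ g : G, 0 < g) {ι : Type*} {S : Set (Option ι → G)}
    (hS : FinDet (halfspaceFamily G (Option ι)) S) :
    FinDet (halfspaceFamily G ι) {z | ∃ a, (fun o : Option ι => o.elim a z) ∈ S} := by
  classical
  obtain ⟨s, hs⟩ := hS
  let slope : G × (Option ι →₀ ℤ) → ℤ := fun p => p.2 none
  let rest : G × (Option ι →₀ ℤ) → G × (ι →₀ ℤ) := fun p => (p.1, p.2.some)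
  have hval : ∀ (p : G × (Option ι →₀ ℤ)) (a : G) (z : ι → G),
      (fun o : Option ι => o.elim a z) ∈ halfspaceFamily G (Option ι) p ↔
        0 ≤ affineFun z (rest p) + slope p • a := by
    intro p a z
    rw [halfspaceFamily, Set.mem_ofPred_eq, Finsupp.linearCombination_option, affineFun_apply,
      add_assoc, add_comm (p.2 none • _)]
    rfl
  have hcrit : ∀ (p : G × (Option ι →₀ ℤ)) (z : ι → G), ∃ e : G,
      slope p ≠ 0 → slope p • e = -affineFun z (rest p) := by
    intro p z
    by_cases h : slope p = 0
    · exact ⟨0, fun h' => absurd h h'⟩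
    · obtain ⟨e, he⟩ := exists_zsmul_eq hdiv _ h (-affineFun z (rest p))
      exact ⟨e, fun _ => he⟩
  choose crit hcrit using hcrit
  let diff : (G × (Option ι →₀ ℤ)) × (G × (Option ι →₀ ℤ)) → G × (ι →₀ ℤ) := fun q =>
    (slope q.1 * slope q.2 ^ 2) • rest q.1 - (slope q.2 * slope q.1 ^ 2) • rest q.2
  refine ⟨s.image rest ∪ (s ×ˢ s).image diff, ?_⟩
  rintro x y hxy ⟨a, ha⟩
  let T := s.filter fun p => slope p ≠ 0
  have hcmp : ∀ p ∈ T, ∀ r ∈ T, (crit p x ≤ crit r x ↔ crit p y ≤ crit r y) := by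
    intro p hp r hr
    obtain ⟨hps, hp0⟩ := Finset.mem_filter.1 hp
    obtain ⟨hrs, hr0⟩ := Finset.mem_filter.1 hr
    rw [le_iff_zero_le_of_zsmul_eq hp0 hr0 (hcrit p x hp0) (hcrit r x hr0),
      le_iff_zero_le_of_zsmul_eq hp0 hr0 (hcrit p y hp0) (hcrit r y hr0), ← map_zsmul, ← map_zsmul,
      ← map_zsmul, ← map_zsmul, ← map_sub, ← map_sub]
    exact hxy (diff (p, r)) (Finset.mem_union_right _ (Finset.mem_image_of_mem diff
      (Finset.mem_product.2 ⟨hps, hrs⟩)))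
  obtain ⟨a', ha'⟩ := exists_same_cut hdiv hpos T (fun p => crit p x) (fun p => crit p y) hcmp a
  refine ⟨a', hs _ _ (fun p hp => ?_) ha⟩
  rw [hval, hval]
  rcases lt_trichotomy (slope p) 0 with h | h | h
  · rw [(zero_le_zsmul_add_iff (hcrit p x h.ne)).2 h, (zero_le_zsmul_add_iff (hcrit p y h.ne)).2 h]
    exact (ha' p (Finset.mem_filter.2 ⟨hp, h.ne⟩)).1
  · rw [h, zero_smul, zero_smul, add_zero, add_zero]
    exact hxy (rest p) (Finset.mem_union_left _ (Finset.mem_image_of_mem rest hp))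
  · rw [(zero_le_zsmul_add_iff (hcrit p x h.ne')).1 h,
      (zero_le_zsmul_add_iff (hcrit p y h.ne')).1 h]
    exact (ha' p (Finset.mem_filter.2 ⟨hp, h.ne'⟩)).2

/-- Quantifier elimination for non-trivial divisible ordered abelian groups. -/
theorem finDet_halfspace_of_definable (hdiv : ∀ n : ℕ, n ≠ 0 → ∀ g : G, ∃ h, n • h = g)
    (hpos : ∃ g : G, 0 < g) {α : Type} {C : Set G} {S : Set (α → G)} (hS : C.Definable oag S) :
    FinDet (halfspaceFamily G α) S := by
  refine definable_induction (fun ι S => FinDet (halfspaceFamily G ι) S)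
    (fun ι => FinDet.empty _) (fun ι S => FinDet.compl) (fun ι S T => FinDet.inter) ?_
    (fun ι S h => finDet_halfspace_projection hdiv hpos h) ?_ ?_ hS
  · intro ι κ g S h
    refine (h.preimage fun z => z ∘ g).trans fun p => ?_
    convert! FinDet.basic (halfspaceFamily G κ) (p.1, p.2.mapDomain g) using 1
    ext z
    simp [halfspaceFamily, Finsupp.linearCombination_mapDomain]
  · intro ι t₁ t₂
    obtain ⟨p₁, h₁⟩ := exists_affineFun_of_term t₁
    obtain ⟨p₂, h₂⟩ := exists_affineFun_of_term t₂
    convert! (FinDet.basic (halfspaceFamily G ι) (p₁ - p₂)).inter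
      (FinDet.basic (halfspaceFamily G ι) (p₂ - p₁)) using 1
    ext z
    rw [Set.mem_ofPred_eq, h₁, h₂]
    change _ ↔ 0 ≤ affineFun z (p₁ - p₂) ∧ 0 ≤ affineFun z (p₂ - p₁)
    rw [map_sub, map_sub, sub_nonneg, sub_nonneg, and_comm, le_antisymm_iff]
  · intro ι n R ts
    choose p hp using fun l => exists_affineFun_of_term (ts l)
    cases R with
    | le =>
      convert! FinDet.basic (halfspaceFamily G ι) (p 1 - p 0) using 1
      ext z
      rw [Set.mem_ofPred_eq]
      change (ts 0).realize (Sum.elim id z) ≤ (ts 1).realize (Sum.elim id z) ↔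
        0 ≤ affineFun z (p 1 - p 0)
      rw [map_sub, sub_nonneg, hp, hp]

end DivisibleGroups

/-! ### Cuts in the value group and definability of types -/

section Cuts

variable {Γ : Type*} [AddCommGroup Γ] [LinearOrder Γ]

/-- The cut of `γ` in the subgroup `H` is infinite or has an endpoint in `H`. -/
def HasEndpoint (H : AddSubgroup Γ) (γ : Γ) : Prop :=
  (∀ δ ∈ H, γ ≤ δ) ∨ (∀ δ ∈ H, δ < γ) ∨ (∃ c ∈ H, ∀ δ ∈ H, (γ ≤ δ ↔ c ≤ δ)) ∨
    ∃ c ∈ H, ∀ δ ∈ H, (γ ≤ δ ↔ c < δ)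

/-- The elements of `Δ` nearest to `γ` on either side are not endpoints of the cut, so `H` has
elements strictly nearer on both sides. -/
theorem exists_avoiding_of_not_hasEndpoint {H : AddSubgroup Γ} {γ : Γ} (h : ¬ HasEndpoint H γ)
    (Δ : Finset Γ) (hΔ : ∀ d ∈ Δ, d ∈ H) :
    ∃ δ₁ ∈ H, ∃ δ₂ ∈ H, δ₁ < γ ∧ γ ≤ δ₂ ∧ ∀ d ∈ Δ, d < δ₁ ∨ δ₂ < d := by
  classical
  simp only [HasEndpoint, not_or] at h
  obtain ⟨h1, h2, h3, h4⟩ := h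
  push Not at h1 h2
  obtain ⟨l₀, hl₀, hl₀γ⟩ := h1
  obtain ⟨u₀, hu₀, hu₀γ⟩ := h2
  obtain ⟨l, hl, hlmax⟩ := (insert l₀ (Δ.filter (· < γ))).exists_max_image id
    (Finset.insert_nonempty _ _)
  obtain ⟨u, hu, humin⟩ := (insert u₀ (Δ.filter (γ ≤ ·))).exists_min_image id
    (Finset.insert_nonempty _ _)
  have hl' : l ∈ H ∧ l < γ := by
    rcases Finset.mem_insert.1 hl with rfl | hl
    · exact ⟨hl₀, hl₀γ⟩
    · exact ⟨hΔ _ (Finset.mem_filter.1 hl).1, (Finset.mem_filter.1 hl).2⟩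
  have hu' : u ∈ H ∧ γ ≤ u := by
    rcases Finset.mem_insert.1 hu with rfl | hu
    · exact ⟨hu₀, hu₀γ⟩
    · exact ⟨hΔ _ (Finset.mem_filter.1 hu).1, (Finset.mem_filter.1 hu).2⟩
  obtain ⟨δ₁, hδ₁, hlδ, hδγ⟩ : ∃ δ ∈ H, l < δ ∧ δ < γ := by
    by_contra hno
    push Not at hno
    exact h4 ⟨l, hl'.1, fun δ hδ => ⟨fun h => hl'.2.trans_le h, hno δ hδ⟩⟩
  obtain ⟨δ₂, hδ₂, hδu, hγδ⟩ : ∃ δ ∈ H, δ < u ∧ γ ≤ δ := by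
    by_contra hno
    push Not at hno
    refine h3 ⟨u, hu'.1, fun δ hδ => ⟨fun h => ?_, hu'.2.trans⟩⟩
    by_contra hlt
    exact absurd h (not_le.2 (hno δ hδ (not_le.1 hlt)))
  refine ⟨δ₁, hδ₁, δ₂, hδ₂, hδγ, hγδ, fun d hd => ?_⟩
  rcases lt_or_ge d γ with hdγ | hdγ
  · exact Or.inl ((hlmax d (Finset.mem_insert_of_mem (Finset.mem_filter.2 ⟨hd, hdγ⟩))).trans_lt hlδ)
  · exact Or.inr
      (hδu.trans_le (humin d (Finset.mem_insert_of_mem (Finset.mem_filter.2 ⟨hd, hdγ⟩))))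

variable [IsOrderedAddMonoid Γ]

theorem hasEndpoint_of_definable (H : AddSubgroup Γ)
    (hdiv : ∀ n : ℕ, n ≠ 0 → ∀ g : H, ∃ h, n • h = g) (hpos : ∃ g : H, 0 < g) {γ : Γ}
    (hγ : (Set.univ : Set H).Definable oag {b : Fin 1 → H | γ ≤ b 0}) : HasEndpoint H γ := by
  classical
  by_contra hnot
  obtain ⟨s, hs⟩ := finDet_halfspace_of_definable hdiv hpos hγ
  have hcrit : ∀ p : H × (Fin 1 →₀ ℤ), ∃ e : H, p.2 0 ≠ 0 → p.2 0 • e = -p.1 := by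
    intro p
    by_cases h : p.2 0 = 0
    · exact ⟨0, fun h' => absurd h h'⟩
    · obtain ⟨e, he⟩ := exists_zsmul_eq hdiv _ h (-p.1)
      exact ⟨e, fun _ => he⟩
  choose crit hcrit using hcrit
  obtain ⟨δ₁, h₁, δ₂, h₂, hlt, hle, hav⟩ := exists_avoiding_of_not_hasEndpoint hnot
    (s.image fun p => (crit p : Γ)) (by
      intro d hd
      obtain ⟨p, -, rfl⟩ := Finset.mem_image.1 hd
      exact (crit p).2)
  have hlt' := hlt.trans_le hle
  refine absurd (hs (fun _ => ⟨δ₂, h₂⟩) (fun _ => ⟨δ₁, h₁⟩) (fun p hp => ?_) hle) (not_le.2 hlt)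
  have hval : ∀ d : H, Finsupp.linearCombination ℤ (fun _ : Fin 1 => d) p.2 = p.2 0 • d := by
    intro d
    rw [Finsupp.linearCombination_apply, Finsupp.sum_fintype _ _ (by simp)]
    simp
  rw [halfspaceFamily, Set.mem_ofPred_eq, Set.mem_ofPred_eq, hval, hval]
  have hc := hav _ (Finset.mem_image_of_mem _ hp)
  rcases lt_trichotomy (p.2 0) 0 with h | h | h
  · rw [(zero_le_zsmul_add_iff (hcrit p h.ne)).2 h, (zero_le_zsmul_add_iff (hcrit p h.ne)).2 h]
    rw [← Subtype.coe_le_coe, ← Subtype.coe_le_coe]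
    rcases hc with hc | hc
    · exact iff_of_false (not_le.2 (hc.trans hlt')) (not_le.2 hc)
    · exact iff_of_true hc.le (hlt'.trans hc).le
  · simp [h]
  · rw [(zero_le_zsmul_add_iff (hcrit p h.ne')).1 h, (zero_le_zsmul_add_iff (hcrit p h.ne')).1 h]
    rw [← Subtype.coe_le_coe, ← Subtype.coe_le_coe]
    rcases hc with hc | hc
    · exact iff_of_true (hc.trans hlt').le hc.le
    · exact iff_of_false (not_le.2 hc) (not_le.2 (hlt'.trans hc))

/-- The trace of a half-space of `Γ` on a subgroup that realizes its cuts. -/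
theorem definable_halfspace_trace {H : AddSubgroup Γ} (hend : ∀ γ, HasEndpoint H γ) {m : ℕ}
    (p : Γ × (Fin m →₀ ℤ)) : (Set.univ : Set H).Definable oag
      ((fun (b : Fin m → H) l => (b l : Γ)) ⁻¹' halfspaceFamily Γ (Fin m) p) := by
  obtain ⟨t, ht⟩ := exists_term_linearCombination (G := H) p.2
  have hmem : ∀ b : Fin m → H,
      b ∈ (fun (b : Fin m → H) l => (b l : Γ)) ⁻¹' halfspaceFamily Γ (Fin m) p ↔
        -p.1 ≤ (Finsupp.linearCombination ℤ b p.2 : H) := by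
    intro b
    have : Finsupp.linearCombination ℤ (fun l => (b l : Γ)) p.2 =
        (Finsupp.linearCombination ℤ b p.2 : H) := by
      rw [Finsupp.linearCombination_apply, Finsupp.linearCombination_apply, Finsupp.sum,
        Finsupp.sum, AddSubgroup.val_finsetSum]
      rfl
    rw [Set.mem_preimage, halfspaceFamily, Set.mem_ofPred_eq, this, neg_le_iff_add_nonneg']
  let rle : oag.Relations 2 := orderRel.le
  rcases hend (-p.1) with h | h | ⟨c, hc, h⟩ | ⟨c, hc, h⟩
  · convert! Set.definable_univ using 1
    ext b
    exact ⟨fun _ => trivial, fun _ => (hmem b).2 (h _ (Subtype.prop _))⟩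
  · convert! Set.definable_empty using 1
    ext b
    exact ⟨fun hb => absurd ((hmem b).1 hb) (not_le.2 (h _ (Subtype.prop _))), fun hb => hb.elim⟩
  · convert! definable_rel₂ (M := H) rle (Term.var (Sum.inl ⟨c, hc⟩)) t using 1
    ext b
    rw [hmem, h _ (Subtype.prop _), Set.mem_ofPred_eq, ht]
    rfl
  · convert! (definable_rel₂ (M := H) rle t (Term.var (Sum.inl ⟨c, hc⟩))).compl using 1
    ext b
    rw [hmem, h _ (Subtype.prop _), Set.mem_compl_iff, Set.mem_ofPred_eq, ht, ← not_le]
    rfl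

/-- Forward, the formula `x ≤ y` alone suffices. Backward, quantifier elimination in `Γ` reduces to
half-spaces, whose traces on `H` are definable by the endpoints. -/
theorem T_iff_hasEndpoint (H : AddSubgroup Γ)
    (hdivH : ∀ n : ℕ, n ≠ 0 → ∀ g : H, ∃ h, n • h = g) (hposH : ∃ g : H, 0 < g)
    (hdiv : ∀ n : ℕ, n ≠ 0 → ∀ g : Γ, ∃ h, n • h = g) :
    T oag 1 (oagInclusion H) ↔ ∀ γ, HasEndpoint H γ := by
  constructor
  · intro hT γ
    let rle : oag.Relations 2 := orderRel.le
    refine hasEndpoint_of_definable H hdivH hposH ?_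
    have := hT (fun _ => γ) 1 (rle.formula₂ (Term.var (Sum.inr 0)) (Term.var (Sum.inl 0)))
    convert! this using 1
  · intro hend a m φ
    have hdef : (Set.univ : Set Γ).Definable oag
        {z : Fin m → Γ | φ.Realize (Sum.elim z a)} := by
      rw [Set.definable_iff_exists_formula_sum]
      refine ⟨φ.relabel (Sum.elim Sum.inr fun l => Sum.inl ⟨a l, trivial⟩), ?_⟩
      ext z
      rw [Set.mem_ofPred_eq, Set.mem_ofPred_eq, Formula.realize_relabel]
      refine iff_of_eq (congrArg _ ?_)
      ext (l | l) <;> rfl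
    have hpos : ∃ g : Γ, 0 < g := hposH.imp' Subtype.val fun g hg => hg
    have := ((finDet_halfspace_of_definable hdiv hpos hdef).preimage
      fun (b : Fin m → H) l => (b l : Γ)).definable (definable_halfspace_trace hend)
    convert! this using 1
    ext b
    simp only [tp, Set.mem_ofPred_eq, Formula.realize_relabel, Set.mem_preimage]
    refine iff_of_eq (congrArg _ ?_)
    ext (l | l) <;> rfl

end Cuts

/-! ### Traces of balls on the subfield -/

section SubfieldTraces

variable {L : Type*} {Γ : Type*} [Field L] [AddCommGroup Γ] [LinearOrder Γ] [IsOrderedAddMonoid Γ]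
  (v : AddValuation L (WithTop Γ))

/-- Either `a` dominates both differences, which then share the value `v a`, or they keep the values
`δ₁` and `δ₂`, which `v c` does not separate. -/
theorem comparisons_iff_of_avoids {x₁ x₂ a c : L} {δ₁ δ₂ : Γ} (h₁ : v x₁ = δ₁) (h₂ : v x₂ = δ₂)
    (h : δ₁ < δ₂) (ha : v a < δ₁ ∨ δ₂ < v a) (hc : v c < δ₁ ∨ δ₂ < v c) :
    (v c ≤ v (x₁ - a) ↔ v c ≤ v (x₂ - a)) ∧ (v c < v (x₁ - a) ↔ v c < v (x₂ - a)) := by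
  have h' : (δ₁ : WithTop Γ) < δ₂ := WithTop.coe_lt_coe.2 h
  rcases ha with ha | ha
  · rw [v.map_sub_eq_of_lt_right (by rwa [h₁]), v.map_sub_eq_of_lt_right (by
      rw [h₂]; exact ha.trans h')]
    exact ⟨Iff.rfl, Iff.rfl⟩
  · rw [v.map_sub_eq_of_lt_left (by rw [h₁]; exact h'.trans ha),
      v.map_sub_eq_of_lt_left (by rwa [h₂]), h₁, h₂]
    rcases hc with hc | hc
    · exact ⟨iff_of_true hc.le (hc.trans h').le, iff_of_true hc (hc.trans h')⟩
    · exact ⟨iff_of_false (not_le.2 (h'.trans hc)) (not_le.2 hc),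
        iff_of_false (not_lt.2 (h'.trans hc).le) (not_lt.2 hc.le)⟩

variable {v}

theorem exists_map_eq_coe {x : L} (hx : x ≠ 0) : ∃ γ : Γ, v x = γ :=
  WithTop.ne_top_iff_exists.1 (fun h => hx (v.top_iff.1 h)) |>.imp fun _ h => h.symm

theorem map_eq_top_or_mem_valueGroup {K : Subfield L} (x : K) :
    v (x : L) = ⊤ ∨ ∃ δ ∈ valueGroup v K, v (x : L) = (δ : WithTop Γ) := by
  by_cases hx : (x : L) = 0
  · left
    simp [hx]
  · obtain ⟨δ, hδ⟩ := exists_map_eq_coe (v := v) hx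
    exact Or.inr ⟨δ, ⟨x, x.2, hδ⟩, hδ⟩

theorem exists_nsmul_eq_of_isAlgClosed [IsAlgClosed L] {n : ℕ} (hn : n ≠ 0) {x : L} {γ : Γ}
    (hx : v x = γ) : ∃ (y : L) (δ : Γ), v y = δ ∧ n • δ = γ := by
  obtain ⟨y, rfl⟩ := IsAlgClosed.exists_pow_nat_eq x (Nat.pos_of_ne_zero hn)
  have hy : y ≠ 0 := by
    rintro rfl
    simp [hn] at hx
  obtain ⟨δ, hδ⟩ := exists_map_eq_coe (v := v) hy
  refine ⟨y, δ, hδ, ?_⟩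
  rw [v.map_pow, hδ] at hx
  exact_mod_cast hx

theorem valueGroup_divisible {K : Subfield L} [IsAlgClosed K] (n : ℕ) (hn : n ≠ 0)
    (g : valueGroup v K) : ∃ h, n • h = g := by
  obtain ⟨γ, x, hxK, hx⟩ := g
  obtain ⟨y, δ, hy, hδ⟩ := exists_nsmul_eq_of_isAlgClosed (v := v.comap K.subtype) hn
    (x := ⟨x, hxK⟩) hx
  exact ⟨⟨δ, y, y.2, hy⟩, Subtype.ext hδ⟩

theorem exists_pos_valueGroup {K : Subfield L} (hK : IsModel (v.comap K.subtype)) :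
    ∃ g : valueGroup v K, 0 < g := by
  obtain ⟨x, hx, hvx⟩ := hK.exists_pos
  obtain ⟨γ, hγ⟩ := exists_map_eq_coe (v := v.comap K.subtype) hx
  rw [hγ] at hvx
  exact ⟨⟨γ, x, x.2, hγ⟩, Subtype.coe_lt_coe.1 (WithTop.coe_pos.1 hvx)⟩

theorem hasEndpoint_of_definable_ball {K : Subfield L} (hK : IsModel (v.comap K.subtype)) {γ : Γ}
    (h : letI := valuedFieldStructure (v.comap K.subtype)
      (Set.univ : Set K).Definable ldiv {z : Fin 1 → K | (γ : WithTop Γ) ≤ v (z 0 : L)}) :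
    HasEndpoint (valueGroup v K) γ := by
  classical
  by_contra hnot
  obtain ⟨s, hs⟩ := finDet_balls_of_definable (v.comap K.subtype) hK h
  let C : Finset (K × K) := s.image (Sum.elim id id)
  obtain ⟨δ₁, ⟨x₁, hx₁K, hx₁⟩, δ₂, ⟨x₂, hx₂K, hx₂⟩, hlt, hle, hav⟩ :=
    exists_avoiding_of_not_hasEndpoint hnot
      ((C.image Prod.fst ∪ C.image Prod.snd).image fun a : K => (v (a : L)).untopD 0) (by
        intro d hd
        obtain ⟨a, -, rfl⟩ := Finset.mem_image.1 hd
        rcases map_eq_top_or_mem_valueGroup (v := v) a with h | ⟨δ, hδ, h⟩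
        · rw [h]
          exact zero_mem _
        · rw [h]
          exact hδ)
  have hav' : ∀ a : K, a ∈ C.image Prod.fst ∪ C.image Prod.snd →
      v (a : L) < δ₁ ∨ (δ₂ : WithTop Γ) < v (a : L) := by
    intro a ha
    have := hav _ (Finset.mem_image_of_mem _ ha)
    rcases map_eq_top_or_mem_valueGroup (v := v) a with h | ⟨δ, hδ, h⟩
    · rw [h]
      exact Or.inr (WithTop.coe_lt_top _)
    · rw [h] at this ⊢
      exact this.imp WithTop.coe_lt_coe.2 WithTop.coe_lt_coe.2
  have key : ∀ p ∈ C, _ := fun p hp => comparisons_iff_of_avoids (v.comap K.subtype)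
    (x₁ := ⟨x₁, hx₁K⟩) (x₂ := ⟨x₂, hx₂K⟩) (a := p.1) (c := p.2) hx₁ hx₂ (hlt.trans_le hle)
    (hav' p.1 (Finset.mem_union_left _ (Finset.mem_image_of_mem _ hp)))
    (hav' p.2 (Finset.mem_union_right _ (Finset.mem_image_of_mem _ hp)))
  have hγ₂ : (γ : WithTop Γ) ≤ v x₂ := hx₂ ▸ WithTop.coe_le_coe.2 hle
  have hγ₁ : ¬ (γ : WithTop Γ) ≤ v x₁ := hx₁ ▸ not_le.2 (WithTop.coe_lt_coe.2 hlt)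
  refine hγ₁ (hs (fun _ => ⟨x₂, hx₂K⟩) (fun _ => ⟨x₁, hx₁K⟩) ?_ hγ₂)
  rintro (p | p) hp
  · have := (key p (Finset.mem_image.2 ⟨_, hp, rfl⟩)).1
    simp only [Set.mem_preimage, ballFamily, Set.mem_ofPred_eq, valuationRing_valuation_le_iff,
      RingHom.id_apply]
    exact this.symm
  · have := (key p (Finset.mem_image.2 ⟨_, hp, rfl⟩)).2
    simp only [Set.mem_preimage, ballFamily, Set.mem_ofPred_eq, valuationRing_valuation_lt_iff,
      RingHom.id_apply]
    exact this.symm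

theorem definable_le_of_hasEndpoint {K : Subfield L} {γ : Γ} (h : HasEndpoint (valueGroup v K) γ)
    (a : K) :
    letI := valuedFieldStructure (v.comap K.subtype)
    (Set.univ : Set K).Definable ldiv
      {z : Fin 1 → K | (γ : WithTop Γ) ≤ v ((z 0 - a : K) : L)} := by
  let := valuedFieldStructure (v.comap K.subtype)
  rcases h with h | h | ⟨c, ⟨e, heK, he⟩, h⟩ | ⟨c, ⟨e, heK, he⟩, h⟩
  · convert! Set.definable_univ using 1
    ext z
    rw [Set.mem_ofPred_eq]
    refine iff_of_true ?_ trivial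
    rcases map_eq_top_or_mem_valueGroup (v := v) (z 0 - a) with h' | ⟨δ, hδ, h'⟩
    · rw [h']
      exact le_top
    · rw [h']
      exact WithTop.coe_le_coe.2 (h δ hδ)
  -- For `γ` above all of `vK` only the value `⊤` qualifies: the trace is the point `a`, written
  -- with radius element `0`.
  · convert! definable_le_map_sub (v.comap K.subtype) 0 a using 1
    ext z
    rw [Set.mem_ofPred_eq, Set.mem_ofPred_eq, AddValuation.map_zero, top_le_iff]
    change _ ↔ v ((z 0 - a : K) : L) = ⊤
    rcases map_eq_top_or_mem_valueGroup (v := v) (z 0 - a) with h' | ⟨δ, hδ, h'⟩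
    · rw [h']
      exact iff_of_true le_top rfl
    · rw [h']
      exact iff_of_false (not_le.2 (WithTop.coe_lt_coe.2 (h δ hδ))) (WithTop.coe_ne_top)
  · convert! definable_le_map_sub (v.comap K.subtype) ⟨e, heK⟩ a using 1
    ext z
    rw [Set.mem_ofPred_eq, Set.mem_ofPred_eq]
    change _ ↔ v e ≤ v ((z 0 - a : K) : L)
    rw [he]
    rcases map_eq_top_or_mem_valueGroup (v := v) (z 0 - a) with h' | ⟨δ, hδ, h'⟩
    · rw [h']
      exact iff_of_true le_top le_top
    · rw [h', WithTop.coe_le_coe, WithTop.coe_le_coe]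
      exact h δ hδ
  · convert! definable_lt_map_sub (v.comap K.subtype) ⟨e, heK⟩ a using 1
    ext z
    rw [Set.mem_ofPred_eq, Set.mem_ofPred_eq]
    change _ ↔ v e < v ((z 0 - a : K) : L)
    rw [he]
    rcases map_eq_top_or_mem_valueGroup (v := v) (z 0 - a) with h' | ⟨δ, hδ, h'⟩
    · rw [h']
      exact iff_of_true le_top (WithTop.coe_lt_top _)
    · rw [h', WithTop.coe_le_coe, WithTop.coe_lt_coe]
      exact h δ hδ

theorem definable_lt_of_hasEndpoint {K : Subfield L} {γ : Γ} (h : HasEndpoint (valueGroup v K) γ)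
    (a : K) :
    letI := valuedFieldStructure (v.comap K.subtype)
    (Set.univ : Set K).Definable ldiv
      {z : Fin 1 → K | (γ : WithTop Γ) < v ((z 0 - a : K) : L)} := by
  let := valuedFieldStructure (v.comap K.subtype)
  by_cases hγ : γ ∈ valueGroup v K
  · obtain ⟨e, heK, he⟩ := hγ
    convert! definable_lt_map_sub (v.comap K.subtype) ⟨e, heK⟩ a using 1
    rw [← he]
    rfl
  -- No element of `K` has value `γ`, so open and closed balls have the same trace.
  · convert! definable_le_of_hasEndpoint h a using 1
    ext z
    rw [Set.mem_ofPred_eq, Set.mem_ofPred_eq]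
    refine ⟨le_of_lt, fun hle => lt_of_le_of_ne hle fun heq => hγ ⟨_, (z 0 - a).2, heq.symm⟩⟩

/-- Any point of a ball is a centre: the trace is empty or the ball can be recentred at a point of
`K`, leaving only its radius outside `K`. -/
theorem definable_ball_trace {K : Subfield L} (hend : ∀ γ, HasEndpoint (valueGroup v K) γ)
    {B : Set L} (hB : IsBall v B) :
    letI := valuedFieldStructure (v.comap K.subtype)
    (Set.univ : Set K).Definable₁ ldiv {x : K | (x : L) ∈ B} := by
  let := valuedFieldStructure (v.comap K.subtype)
  rw [Set.Definable₁]
  by_cases hne : ∃ b : K, (b : L) ∈ B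
  · obtain ⟨b, hb⟩ := hne
    obtain ⟨a, γ, rfl | rfl⟩ := hB
    · refine (congrArg _ ?_).mp (definable_le_of_hasEndpoint (hend γ) b)
      ext z
      have hb' : (γ : WithTop Γ) ≤ v ((b : L) - a) := hb
      change (γ : WithTop Γ) ≤ v ((z 0 : L) - b) ↔ (γ : WithTop Γ) ≤ v ((z 0 : L) - a)
      constructor <;> intro h
      · rw [show (z 0 : L) - a = ((z 0 : L) - b) + (b - a) by ring]
        exact v.map_le_add h hb'
      · rw [show (z 0 : L) - b = ((z 0 : L) - a) - (b - a) by ring]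
        exact v.map_le_sub h hb'
    · refine (congrArg _ ?_).mp (definable_lt_of_hasEndpoint (hend γ) b)
      ext z
      have hb' : (γ : WithTop Γ) < v ((b : L) - a) := hb
      change (γ : WithTop Γ) < v ((z 0 : L) - b) ↔ (γ : WithTop Γ) < v ((z 0 : L) - a)
      constructor <;> intro h
      · rw [show (z 0 : L) - a = ((z 0 : L) - b) + (b - a) by ring]
        exact v.map_lt_add h hb'
      · rw [show (z 0 : L) - b = ((z 0 : L) - a) - (b - a) by ring]
        exact (lt_min h hb').trans_le (v.map_sub _ _)
  · refine (congrArg _ ?_).mp Set.definable_empty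
    ext z
    exact ⟨fun h => h.elim, fun h => hne ⟨z 0, h⟩⟩

theorem definable_ball (hv : Function.Surjective v) {B : Set L} (hB : IsBall v B) :
    letI := valuedFieldStructure v
    (Set.univ : Set L).Definable₁ ldiv B := by
  let := valuedFieldStructure v
  obtain ⟨a, γ, rfl | rfl⟩ := hB <;> obtain ⟨e, he⟩ := hv γ <;> rw [← he]
  · exact definable_le_map_sub v e a
  · exact definable_lt_map_sub v e a

theorem definable_trace_of_ball_traces {K : Subfield L} (hL : IsModel v)
    (hB : letI := valuedFieldStructure (v.comap K.subtype)
      ∀ B : Set L, IsBall v B → (Set.univ : Set K).Definable₁ ldiv {x : K | (x : L) ∈ B})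
    {S : Set (Fin 1 → L)}
    (hS : letI := valuedFieldStructure v; (Set.univ : Set L).Definable ldiv S) :
    letI := valuedFieldStructure (v.comap K.subtype)
    (Set.univ : Set K).Definable ldiv {x : Fin 1 → K | (fun l => (x l : L)) ∈ S} := by
  let := valuedFieldStructure (v.comap K.subtype)
  refine FinDet.definable ((finDet_balls_of_definable v hL hS).preimage
    fun (x : Fin 1 → K) l => (x l : L)) ?_
  rintro (⟨a, c⟩ | ⟨a, c⟩)
  -- A zero radius element has value `⊤`, which is not the radius of an `IsBall`: the closed ball is
  -- a point and the open one is empty.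
  · by_cases hc : c = 0
    · by_cases ha : a ∈ K
      · refine (congrArg _ ?_).mp (definable_le_map_sub (v.comap K.subtype) 0 ⟨a, ha⟩)
        ext z
        simp only [Set.mem_preimage, ballFamily, Set.mem_ofPred_eq, hc,
          valuationRing_valuation_le_iff, RingHom.id_apply]
        simp [← Subtype.coe_inj]
      · refine (congrArg _ ?_).mp Set.definable_empty
        ext z
        refine ⟨fun h => h.elim, fun h => ha ?_⟩
        simp only [Set.mem_preimage, ballFamily, Set.mem_ofPred_eq, hc, RingHom.id_apply] at h
        have : (z 0 : L) = a := by simpa [sub_eq_zero] using h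
        exact this ▸ (z 0).2
    · obtain ⟨γ, hγ⟩ := exists_map_eq_coe (v := v) hc
      refine (congrArg _ ?_).mp (hB _ ⟨a, γ, Or.inl rfl⟩)
      ext z
      simp only [Set.mem_preimage, ballFamily, Set.mem_ofPred_eq,
        valuationRing_valuation_le_iff, RingHom.id_apply, hγ]
  · by_cases hc : c = 0
    · refine (congrArg _ ?_).mp Set.definable_empty
      ext z
      refine ⟨fun h => h.elim, fun h => ?_⟩
      simp only [Set.mem_preimage, ballFamily, Set.mem_ofPred_eq, hc, RingHom.id_apply] at h
      simp at h
    · obtain ⟨γ, hγ⟩ := exists_map_eq_coe (v := v) hc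
      refine (congrArg _ ?_).mp (hB _ ⟨a, γ, Or.inr rfl⟩)
      ext z
      simp only [Set.mem_preimage, ballFamily, Set.mem_ofPred_eq,
        valuationRing_valuation_lt_iff, RingHom.id_apply, hγ]

end SubfieldTraces

end ACVF

/-! ### The equivalence -/

theorem proposition2p3 {L : Type*} {Γ : Type*} [Field L]
    [AddCommGroup Γ] [LinearOrder Γ] [IsOrderedAddMonoid Γ]
    (v : AddValuation L (WithTop Γ)) (hv : Function.Surjective v) (K : Subfield L)
    (hL : ACVF.IsModel v) (hK : ACVF.IsModel (v.comap K.subtype)) :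
    letI : ACVF.ldiv.Structure L := ACVF.valuedFieldStructure v
    letI : ACVF.ldiv.Structure K := ACVF.valuedFieldStructure (v.comap K.subtype)
    ∀ j : K ↪ₑ[ACVF.ldiv] L, (∀ x : K, j x = (x : L)) →
      List.TFAE [
        ACVF.W ACVF.ldiv 1 j.toEmbedding,
        ∀ B : Set L, ACVF.IsBall v B →
          (Set.univ : Set K).Definable₁ ACVF.ldiv {x : K | (x : L) ∈ B},
        ACVF.T ACVF.oag 1 (ACVF.oagInclusion (ACVF.valueGroup v K))] := by
  let : ACVF.ldiv.Structure L := ACVF.valuedFieldStructure v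
  let : ACVF.ldiv.Structure K := ACVF.valuedFieldStructure (v.comap K.subtype)
  intro j hj
  have := hL.isAlgClosed
  have := hK.isAlgClosed
  have hcomp : ∀ x : Fin 1 → K, j.toEmbedding ∘ x = fun l => (x l : L) := fun x =>
    funext fun l => hj (x l)
  have hT := ACVF.T_iff_hasEndpoint (ACVF.valueGroup v K) ACVF.valueGroup_divisible
    (ACVF.exists_pos_valueGroup hK) fun n hn γ => by
      obtain ⟨x, hx⟩ := hv γ
      obtain ⟨-, δ, -, hδ⟩ := ACVF.exists_nsmul_eq_of_isAlgClosed hn hx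
      exact ⟨δ, hδ⟩
  tfae_have 1 → 2 := by
    intro hW B hB
    rw [Set.Definable₁]
    refine (congrArg _ ?_).mp (hW _ (ACVF.definable_ball hv hB))
    ext x
    rw [Set.mem_ofPred_eq, hcomp]
    rfl
  tfae_have 2 → 1 := by
    intro hB t ht
    simp only [hcomp]
    exact ACVF.definable_trace_of_ball_traces hL hB ht
  tfae_have 2 → 3 := by
    intro hB
    refine hT.2 fun γ => ACVF.hasEndpoint_of_definable_ball hK ?_
    refine (congrArg _ ?_).mp (hB _ ⟨0, γ, Or.inl rfl⟩)
    ext z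
    simp
  tfae_have 3 → 2 := fun h B hB => ACVF.definable_ball_trace (hT.1 h) hB
  tfae_finish
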